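/- Let $\Bbbk$ be an algebraically closed field of characteristic $0$ and $D=\Bbbk[x]/(x^2)$. Let $\mathscr{D}$ be the one-object $2$-category whose $1$-morphisms are the finite-dimensional $D$-$D$-bimodules (with $\Bbbk$ acting centrally), with composition $FG=F\otimes_D G$ and identity $\mathbb{1}=D$, and whose $2$-morphisms are the bimodule homomorphisms. For $k\ge 0$ let $M_k$ be the bimodule with basis $m_1,\dots,m_{2k+3}$ and $x m_j=m_{j+1}$, $m_j x=m_{j-1}$ for $j$ even, $x m_j=m_j x=0$ for $j$ odd; let $N_k=M_k/\mathrm{span}\{m_{2k+3}\}$, and let $\varphi_k:M_k\to D$ be the bimodule homomorphism with $\varphi_k(m_j)=1$ for $j$ even and $\varphi_k(m_j)=x$ for $j$ odd. For indecomposable $1$-morphisms write $F\le_J G$ if $G$ is a direct summand of $H_1FH_2$ for some $H_1,H_2$ in $\mathscr{D}$. For $m\ge 1$ let $\mathscr{D}^{(m)}$ be the $2$-full $2$-subcategory of $\mathscr{D}$ given by the additive closure of $\mathbb{1}$ and all indecomposable $G$ with $G\ge_J M_m$. In $\mathscr{D}^{(m)}$ write $F\le_L G$ if $G$ is a direct summand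 of $HF$ for some $H$ in $\mathscr{D}^{(m)}$; the classes of the induced equivalence relation on indecomposable $1$-morphisms are the left cells. Let $\mathcal{L}$ be a class of $1$-morphisms of $\mathscr{D}^{(m)}$. A $1$-morphism $G$ of $\mathscr{D}^{(m)}$ is good for $\mathcal{L}$ via $\varphi:G\to\mathbb{1}$ if for every $F\in\mathcal{L}$ there is $\xi:F\to FG$ with $F\varphi\circ\xi=\mathrm{id}_F$. It is great for $\mathcal{L}$ via $\varphi$ if it is good for $\mathcal{L}$ via $\varphi$ and, for every $1$-morphism $G'$ of $\mathscr{D}^{(m)}$ that is good for $\mathcal{L}$ via some $\varphi':G'\to\mathbb{1}$, there is $\beta:G\to G'$ with $\varphi=\varphi'\circ\beta$. Proposition. For all $m\ge k\ge 1$, the $1$-morphism $M_k$ of $\mathscr{D}^{(m)}$ is great for $\mathcal{L}=\{N_k,M_k\}$ via $\varphi_k$. Moreover, $N_k$ and $M_k$ lie in one left cell of $\mathscr{D}^{(m)}$, and $M_k$ is also great via $\varphi_k$ for this whole left cell. -/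

import Mathlib

open CategoryTheory MonoidalCategory Limits
open scoped TensorProduct

universe u

/-! # Finite-dimensional bimodules -/

/-- A finite-dimensional `A`-`A`-bimodule over the field `k` (with `k` acting centrally): a
finite-dimensional `k`-vector space with commuting left and right actions of `A`. -/
structure FDBimod (k A : Type u) [Field k] [Ring A] [Algebra k A] where
  carrier : Type u
  [addCommGroup : AddCommGroup carrier]
  [module : Module k carrier]
  [finite : Module.Finite k carrier]
  /-- the left action, `left a v = a • v` -/
  left : A →ₐ[k] Module.End k carrier
  /-- the right action, `right (op a) v = v • a` -/
  right : Aᵐᵒᵖ →ₐ[k] Module.End k carrier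
  left_right : ∀ a b v, left a (right b v) = right b (left a v)

namespace FDBimod

attribute [instance] addCommGroup module finite

section

variable {k A : Type u} [Field k] [Ring A] [Algebra k A]

instance : CoeSort (FDBimod k A) (Type u) := ⟨carrier⟩

/-- Homomorphisms of bimodules. -/
@[ext]
structure Hom (V W : FDBimod k A) where
  toLin : V →ₗ[k] W
  map_left : ∀ a v, toLin (V.left a v) = W.left a (toLin v)
  map_right : ∀ b v, toLin (V.right b v) = W.right b (toLin v)

@[simps id_toLin comp_toLin]
instance : Category (FDBimod k A) where
  Hom := Hom
  id V := ⟨LinearMap.id, fun _ _ => rfl, fun _ _ => rfl⟩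
  comp f g := ⟨g.toLin ∘ₗ f.toLin, by simp [f.map_left, g.map_left],
    by simp [f.map_right, g.map_right]⟩

theorem hom_ext {V W : FDBimod k A} {f g : V ⟶ W} (h : ∀ v, Hom.toLin f v = Hom.toLin g v) :
    f = g :=
  Hom.ext (LinearMap.ext h)

/-! ## The additive structure -/

section Additive

variable {V W : FDBimod k A}

instance : Add (V ⟶ W) :=
  ⟨fun f g => ⟨Hom.toLin f + Hom.toLin g, by simp [Hom.map_left], by simp [Hom.map_right]⟩⟩
instance : Zero (V ⟶ W) := ⟨⟨0, by simp, by simp⟩⟩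
instance : Neg (V ⟶ W) :=
  ⟨fun f => ⟨-Hom.toLin f, by simp [Hom.map_left], by simp [Hom.map_right]⟩⟩

@[simp] theorem add_toLin (f g : V ⟶ W) : Hom.toLin (f + g) = Hom.toLin f + Hom.toLin g := rfl
@[simp] theorem zero_toLin : Hom.toLin (0 : V ⟶ W) = 0 := rfl
@[simp] theorem neg_toLin (f : V ⟶ W) : Hom.toLin (-f) = -Hom.toLin f := rfl

instance : AddCommGroup (V ⟶ W) where
  add_assoc _ _ _ := Hom.ext (add_assoc _ _ _)
  zero_add _ := Hom.ext (zero_add _)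
  add_zero _ := Hom.ext (add_zero _)
  add_comm _ _ := Hom.ext (add_comm _ _)
  neg_add_cancel _ := Hom.ext (neg_add_cancel _)
  nsmul := nsmulRec
  zsmul := zsmulRec

end Additive

instance : Preadditive (FDBimod k A) where
  add_comp _ _ _ f g h := hom_ext fun v => by simp
  comp_add _ _ _ f g h := hom_ext fun v => by simp

/-- The direct sum of two bimodules. -/
@[simps]
def prod (V W : FDBimod k A) : FDBimod k A where
  carrier := V × W
  left :=
    { toFun := fun a => (V.left a).prodMap (W.left a)
      map_one' := by ext <;> simp
      map_mul' := fun a b => by ext <;> simp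
      map_zero' := by ext <;> simp
      map_add' := fun a b => by ext <;> simp
      commutes' := fun r => by ext <;> simp [AlgHom.commutes] }
  right :=
    { toFun := fun a => (V.right a).prodMap (W.right a)
      map_one' := by ext <;> simp
      map_mul' := fun a b => by ext <;> simp
      map_zero' := by ext <;> simp
      map_add' := fun a b => by ext <;> simp
      commutes' := fun r => by
        rw [AlgHom.commutes V.right, AlgHom.commutes W.right]; ext <;> simp }
  left_right a b v := Prod.ext (V.left_right a b v.1) (W.left_right a b v.2)

/-- The direct sum with its inclusions and projections. -/
def prodBicone (V W : FDBimod k A) : BinaryBicone V W where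
  pt := prod V W
  fst := ⟨LinearMap.fst k V W, fun _ _ => rfl, fun _ _ => rfl⟩
  snd := ⟨LinearMap.snd k V W, fun _ _ => rfl, fun _ _ => rfl⟩
  inl := ⟨LinearMap.inl k V W, fun a _ => Prod.ext rfl (map_zero (W.left a)).symm,
    fun a _ => Prod.ext rfl (map_zero (W.right a)).symm⟩
  inr := ⟨LinearMap.inr k V W, fun a _ => Prod.ext (map_zero (V.left a)).symm rfl,
    fun a _ => Prod.ext (map_zero (V.right a)).symm rfl⟩
  inl_fst := rfl
  inl_snd := rfl
  inr_fst := rfl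
  inr_snd := rfl

instance : HasBinaryBiproducts (FDBimod k A) where
  has_binary_biproduct V W := hasBinaryBiproduct_of_total (prodBicone V W)
    (hom_ext fun v => Prod.ext (add_zero v.1) (zero_add v.2))

/-! ## The tensor product over `A` -/

/-- The relations `v • a ⊗ w = v ⊗ a • w`. -/
def tensorRel (V W : FDBimod k A) : Submodule k (V ⊗[k] W) :=
  Submodule.span k
    (Set.range fun p : V × A × W =>
      V.right (.op p.2.1) p.1 ⊗ₜ[k] p.2.2 - p.1 ⊗ₜ[k] W.left p.2.1 p.2.2)

/-- The vector space underlying the tensor product `V ⊗ W` over `A`. -/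
abbrev TensorCarrier (V W : FDBimod k A) : Type u := (V ⊗[k] W) ⧸ tensorRel V W

/-- The linear map induced on the tensor product over `A` by a balanced bilinear map. -/
def liftAux {V W : FDBimod k A} {Z : Type u} [AddCommGroup Z] [Module k Z] (f : V →ₗ[k] W →ₗ[k] Z)
    (hf : ∀ v a w, f (V.right (.op a) v) w = f v (W.left a w)) : TensorCarrier V W →ₗ[k] Z :=
  (tensorRel V W).liftQ (TensorProduct.lift f) (by
    refine Submodule.span_le.2 ?_
    rintro _ ⟨⟨v, a, w⟩, rfl⟩
    simp [hf])

theorem extAux {V W : FDBimod k A} {Z : Type u} [AddCommGroup Z] [Module k Z]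
    {f g : TensorCarrier V W →ₗ[k] Z}
    (h : ∀ v w, f (Submodule.Quotient.mk (v ⊗ₜ[k] w)) = g (Submodule.Quotient.mk (v ⊗ₜ[k] w))) :
    f = g :=
  Submodule.linearMap_qext _ (TensorProduct.ext' h)

/-- The map `v ⊗ w ↦ a • v ⊗ w` on the tensor product over `A`. -/
def leftAux (V W : FDBimod k A) (a : A) : Module.End k (TensorCarrier V W) :=
  liftAux (((TensorProduct.mk k V W).compr₂ (tensorRel V W).mkQ).comp (V.left a)) fun v b w =>
    (Submodule.Quotient.eq _).2
      (Submodule.subset_span ⟨(V.left a v, b, w), by simp [V.left_right]⟩)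

/-- The map `v ⊗ w ↦ v ⊗ w • b` on the tensor product over `A`. -/
def rightAux (V W : FDBimod k A) (b : Aᵐᵒᵖ) : Module.End k (TensorCarrier V W) :=
  liftAux (((TensorProduct.mk k V W).compr₂ (tensorRel V W).mkQ).compl₂ (W.right b)) fun v a w =>
    (Submodule.Quotient.eq _).2
      (Submodule.subset_span ⟨(v, a, W.right b w), by simp [W.left_right]⟩)

theorem leftAux_mk (V W : FDBimod k A) (a : A) (v : V) (w : W) :
    leftAux V W a (Submodule.Quotient.mk (v ⊗ₜ[k] w)) =
      Submodule.Quotient.mk (V.left a v ⊗ₜ[k] w) := rfl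

theorem rightAux_mk (V W : FDBimod k A) (b : Aᵐᵒᵖ) (v : V) (w : W) :
    rightAux V W b (Submodule.Quotient.mk (v ⊗ₜ[k] w)) =
      Submodule.Quotient.mk (v ⊗ₜ[k] W.right b w) := rfl

/-- The tensor product of bimodules over `A`. -/
def tensor (V W : FDBimod k A) : FDBimod k A where
  carrier := TensorCarrier V W
  left :=
    { toFun := leftAux V W
      map_one' := extAux fun v w => by simp [leftAux_mk]
      map_mul' := fun a b => extAux fun v w => by simp [leftAux_mk]
      map_zero' := extAux fun v w => by simp [leftAux_mk]
      map_add' := fun a b => extAux fun v w => by simp [leftAux_mk, TensorProduct.add_tmul]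
      commutes' := fun r => extAux fun v w => by
        rw [leftAux_mk, AlgHom.commutes V.left]; rfl }
  right :=
    { toFun := rightAux V W
      map_one' := extAux fun v w => by simp [rightAux_mk]
      map_mul' := fun a b => extAux fun v w => by simp [rightAux_mk]
      map_zero' := extAux fun v w => by simp [rightAux_mk]
      map_add' := fun a b => extAux fun v w => by simp [rightAux_mk, TensorProduct.tmul_add]
      commutes' := fun r => extAux fun v w => by
        rw [rightAux_mk, AlgHom.commutes W.right]
        simp [TensorProduct.tmul_smul] }
  left_right a b := LinearMap.congr_fun (f := leftAux V W a ∘ₗ rightAux V W b)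
    (g := rightAux V W b ∘ₗ leftAux V W a) (extAux fun _ _ => rfl)

/-- The pure tensor `v ⊗ w` over `A`. -/
def tmul (V W : FDBimod k A) : V →ₗ[k] W →ₗ[k] tensor V W :=
  (TensorProduct.mk k V W).compr₂ (tensorRel V W).mkQ

theorem tmul_balanced (V W : FDBimod k A) (v : V) (a : A) (w : W) :
    tmul V W (V.right (.op a) v) w = tmul V W v (W.left a w) :=
  (Submodule.Quotient.eq _).2 (Submodule.subset_span ⟨(v, a, w), rfl⟩)

@[simp]
theorem tensor_left_tmul (V W : FDBimod k A) (a : A) (v : V) (w : W) :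
    (tensor V W).left a (tmul V W v w) = tmul V W (V.left a v) w := rfl

@[simp]
theorem tensor_right_tmul (V W : FDBimod k A) (b : Aᵐᵒᵖ) (v : V) (w : W) :
    (tensor V W).right b (tmul V W v w) = tmul V W v (W.right b w) := rfl

section Lift

variable {V W : FDBimod k A} {Z : Type u} [AddCommGroup Z] [Module k Z]

/-- The linear map out of `V ⊗ W` (over `A`) given by a balanced bilinear map. -/
def tlift (f : V →ₗ[k] W →ₗ[k] Z)
    (hf : ∀ v a w, f (V.right (.op a) v) w = f v (W.left a w)) : tensor V W →ₗ[k] Z :=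
  liftAux f hf

@[simp]
theorem tlift_tmul (f : V →ₗ[k] W →ₗ[k] Z)
    (hf : ∀ v a w, f (V.right (.op a) v) w = f v (W.left a w)) (v : V) (w : W) :
    tlift f hf (tmul V W v w) = f v w := rfl

theorem tensor_ext {f g : tensor V W →ₗ[k] Z}
    (h : ∀ v w, f (tmul V W v w) = g (tmul V W v w)) : f = g :=
  extAux h

end Lift

theorem tensor_hom_ext {V W Z : FDBimod k A} {f g : tensor V W ⟶ Z}
    (h : ∀ v w, Hom.toLin f (tmul V W v w) = Hom.toLin g (tmul V W v w)) : f = g :=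
  Hom.ext (tensor_ext h)

/-- The bimodule homomorphism out of `V ⊗ W` given by a balanced bilinear map which is compatible
with the outer actions. -/
def tensorDesc {V W Z : FDBimod k A} (f : V →ₗ[k] W →ₗ[k] Z)
    (hf : ∀ v a w, f (V.right (.op a) v) w = f v (W.left a w))
    (hl : ∀ a v w, f (V.left a v) w = Z.left a (f v w))
    (hr : ∀ b v w, f v (W.right b w) = Z.right b (f v w)) : tensor V W ⟶ Z where
  toLin := tlift f hf
  map_left a := LinearMap.congr_fun (f := tlift f hf ∘ₗ (tensor V W).left a)
    (g := Z.left a ∘ₗ tlift f hf) (tensor_ext fun v w => by simp [hl])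
  map_right b := LinearMap.congr_fun (f := tlift f hf ∘ₗ (tensor V W).right b)
    (g := Z.right b ∘ₗ tlift f hf) (tensor_ext fun v w => by simp [hr])

@[simp]
theorem tensorDesc_tmul {V W Z : FDBimod k A} (f : V →ₗ[k] W →ₗ[k] Z) (hf hl hr) (v : V) (w : W) :
    Hom.toLin (tensorDesc (Z := Z) f hf hl hr) (tmul V W v w) = f v w := rfl

/-- The tensor product of two bimodule homomorphisms. -/
def tensorMap {V W V' W' : FDBimod k A} (f : V ⟶ V') (g : W ⟶ W') : tensor V W ⟶ tensor V' W' :=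
  tensorDesc ((tmul V' W').compl₁₂ (Hom.toLin f) (Hom.toLin g))
    (fun v a w => by simp [Hom.map_left, Hom.map_right, tmul_balanced])
    (fun a v w => by simp [Hom.map_left])
    (fun b v w => by simp [Hom.map_right])

@[simp]
theorem tensorMap_tmul {V W V' W' : FDBimod k A} (f : V ⟶ V') (g : W ⟶ W') (v : V) (w : W) :
    Hom.toLin (tensorMap f g) (tmul V W v w) = tmul V' W' (Hom.toLin f v) (Hom.toLin g w) := rfl

/-- The linear map `u ⊗ v ↦ (w ↦ u ⊗ (v ⊗ w))`. -/
def assocAux (U V W : FDBimod k A) : tensor U V →ₗ[k] W →ₗ[k] tensor U (tensor V W) :=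
  tlift (LinearMap.mk₂ k (fun u v => (tmul U (tensor V W) u).comp (tmul V W v))
    (fun _ _ _ => LinearMap.ext fun _ => by simp) (fun _ _ _ => LinearMap.ext fun _ => by simp)
    (fun _ _ _ => LinearMap.ext fun _ => by simp) (fun _ _ _ => LinearMap.ext fun _ => by simp))
    (fun u a v => LinearMap.ext fun w => by simp [tmul_balanced])

@[simp]
theorem assocAux_tmul (U V W : FDBimod k A) (u : U) (v : V) (w : W) :
    assocAux U V W (tmul U V u v) w = tmul U (tensor V W) u (tmul V W v w) := rfl

/-- `(u ⊗ v) ⊗ w ↦ u ⊗ (v ⊗ w)`. -/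
def assocHom (U V W : FDBimod k A) : tensor (tensor U V) W ⟶ tensor U (tensor V W) :=
  tensorDesc (assocAux U V W)
    (fun x a w => LinearMap.congr_fun
      (f := (assocAux U V W).flip w ∘ₗ (tensor U V).right (.op a))
      (g := (assocAux U V W).flip (W.left a w))
      (tensor_ext fun u v => by simp [tmul_balanced]) x)
    (fun a x w => LinearMap.congr_fun
      (f := (assocAux U V W).flip w ∘ₗ (tensor U V).left a)
      (g := (tensor U (tensor V W)).left a ∘ₗ (assocAux U V W).flip w)
      (tensor_ext fun u v => by simp) x)
    (fun b x w => LinearMap.congr_fun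
      (f := (assocAux U V W).flip (W.right b w))
      (g := (tensor U (tensor V W)).right b ∘ₗ (assocAux U V W).flip w)
      (tensor_ext fun u v => by simp) x)

@[simp]
theorem assocHom_tmul (U V W : FDBimod k A) (u : U) (v : V) (w : W) :
    Hom.toLin (assocHom U V W) (tmul (tensor U V) W (tmul U V u v) w) =
      tmul U (tensor V W) u (tmul V W v w) := rfl

/-- The linear map `v ⊗ w ↦ (u ↦ (u ⊗ v) ⊗ w)`. -/
def assocInvAux (U V W : FDBimod k A) : tensor V W →ₗ[k] U →ₗ[k] tensor (tensor U V) W :=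
  tlift (LinearMap.mk₂ k (fun v w => ((tmul (tensor U V) W).flip w).comp ((tmul U V).flip v))
    (fun _ _ _ => LinearMap.ext fun _ => by simp) (fun _ _ _ => LinearMap.ext fun _ => by simp)
    (fun _ _ _ => LinearMap.ext fun _ => by simp) (fun _ _ _ => LinearMap.ext fun _ => by simp))
    (fun v a w => LinearMap.ext fun u => by simp [← tmul_balanced])

@[simp]
theorem assocInvAux_tmul (U V W : FDBimod k A) (u : U) (v : V) (w : W) :
    assocInvAux U V W (tmul V W v w) u = tmul (tensor U V) W (tmul U V u v) w := rfl

/-- `u ⊗ (v ⊗ w) ↦ (u ⊗ v) ⊗ w`. -/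
def assocInv (U V W : FDBimod k A) : tensor U (tensor V W) ⟶ tensor (tensor U V) W :=
  tensorDesc (assocInvAux U V W).flip
    (fun u a x => LinearMap.congr_fun
      (f := (assocInvAux U V W).flip (U.right (.op a) u))
      (g := (assocInvAux U V W).flip u ∘ₗ (tensor V W).left a)
      (tensor_ext fun v w => by simp [tmul_balanced]) x)
    (fun a u x => LinearMap.congr_fun
      (f := (assocInvAux U V W).flip (U.left a u))
      (g := (tensor (tensor U V) W).left a ∘ₗ (assocInvAux U V W).flip u)
      (tensor_ext fun v w => by simp) x)
    (fun b u x => LinearMap.congr_fun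
      (f := (assocInvAux U V W).flip u ∘ₗ (tensor V W).right b)
      (g := (tensor (tensor U V) W).right b ∘ₗ (assocInvAux U V W).flip u)
      (tensor_ext fun v w => by simp) x)

@[simp]
theorem assocInv_tmul (U V W : FDBimod k A) (u : U) (v : V) (w : W) :
    Hom.toLin (assocInv U V W) (tmul U (tensor V W) u (tmul V W v w)) =
      tmul (tensor U V) W (tmul U V u v) w := rfl

theorem tensor_hom_ext₃ {U V W Z : FDBimod k A} {f g : tensor (tensor U V) W ⟶ Z}
    (h : ∀ u v w, Hom.toLin f (tmul _ _ (tmul _ _ u v) w) =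
      Hom.toLin g (tmul _ _ (tmul _ _ u v) w)) : f = g :=
  tensor_hom_ext fun x w => LinearMap.congr_fun
    (f := Hom.toLin f ∘ₗ (tmul (tensor U V) W).flip w)
    (g := Hom.toLin g ∘ₗ (tmul (tensor U V) W).flip w) (tensor_ext fun u v => h u v w) x

theorem tensor_hom_ext₃' {U V W Z : FDBimod k A} {f g : tensor U (tensor V W) ⟶ Z}
    (h : ∀ u v w, Hom.toLin f (tmul _ _ u (tmul _ _ v w)) =
      Hom.toLin g (tmul _ _ u (tmul _ _ v w))) : f = g :=
  tensor_hom_ext fun u x => LinearMap.congr_fun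
    (f := Hom.toLin f ∘ₗ tmul U (tensor V W) u)
    (g := Hom.toLin g ∘ₗ tmul U (tensor V W) u) (tensor_ext fun v w => h u v w) x

theorem tensor_hom_ext₄ {U V W X Z : FDBimod k A} {f g : tensor (tensor (tensor U V) W) X ⟶ Z}
    (h : ∀ u v w x, Hom.toLin f (tmul _ _ (tmul _ _ (tmul _ _ u v) w) x) =
      Hom.toLin g (tmul _ _ (tmul _ _ (tmul _ _ u v) w) x)) : f = g :=
  tensor_hom_ext₃ fun y w x => LinearMap.congr_fun
    (f := Hom.toLin f ∘ₗ (tmul (tensor (tensor U V) W) X).flip x ∘ₗ (tmul (tensor U V) W).flip w)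
    (g := Hom.toLin g ∘ₗ (tmul (tensor (tensor U V) W) X).flip x ∘ₗ (tmul (tensor U V) W).flip w)
    (tensor_ext fun u v => h u v w x) y

variable [Module.Finite k A]

/-- The regular bimodule. -/
def regular (k A : Type u) [Field k] [Ring A] [Algebra k A] [Module.Finite k A] : FDBimod k A where
  carrier := A
  left := Algebra.lmul k A
  right :=
    { toFun := fun b => LinearMap.mulRight k b.unop
      map_one' := by ext; simp
      map_mul' := fun a b => by ext; simp [mul_assoc]
      map_zero' := by ext; simp
      map_add' := fun a b => by ext; simp [mul_add]
      commutes' := fun r => by ext; simp [Algebra.smul_def, Algebra.commutes] }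
  left_right a b v := (mul_assoc a v b.unop).symm

/-- `a ⊗ v ↦ a • v`. -/
def leftUnitorHom (V : FDBimod k A) : tensor (regular k A) V ⟶ V :=
  tensorDesc (W := V) (V := regular k A) V.left.toLinearMap
    (fun (c : A) a v => LinearMap.congr_fun (map_mul V.left c a) v)
    (fun a (c : A) v => LinearMap.congr_fun (map_mul V.left a c) v)
    (fun b (c : A) v => V.left_right c b v)

/-- `v ⊗ a ↦ v • a`. -/
def rightUnitorHom (V : FDBimod k A) : tensor V (regular k A) ⟶ V :=
  tensorDesc (W := regular k A) (V := V)
    (V.right.toLinearMap ∘ₗ (MulOpposite.opLinearEquiv k).toLinearMap).flip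
    (fun v a (c : A) => (LinearMap.congr_fun (map_mul V.right (.op c) (.op a)) v).symm)
    (fun a v (c : A) => (V.left_right a (.op c) v).symm)
    (fun b v (c : A) => LinearMap.congr_fun (map_mul V.right b (.op c)) v)

theorem leftUnitorHom_tmul (V : FDBimod k A) (a : A) (v : V) :
    Hom.toLin (leftUnitorHom V) (tmul (regular k A) V a v) = V.left a v := rfl

theorem rightUnitorHom_tmul (V : FDBimod k A) (v : V) (a : A) :
    Hom.toLin (rightUnitorHom V) (tmul V (regular k A) v a) = V.right (.op a) v := rfl

theorem one_tmul_left (V : FDBimod k A) (a : A) (v : V) :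
    tmul (regular k A) V (1 : A) (V.left a v) = tmul (regular k A) V a v :=
  (tmul_balanced (regular k A) V (1 : A) a v).symm.trans
    (congrArg (fun c : A => tmul (regular k A) V c v) (one_mul a))

theorem right_tmul_one (V : FDBimod k A) (v : V) (a : A) :
    tmul V (regular k A) (V.right (.op a) v) (1 : A) = tmul V (regular k A) v a :=
  (tmul_balanced V (regular k A) v a (1 : A)).trans
    (congrArg (fun c : A => tmul V (regular k A) v c) (mul_one a))

/-- `v ↦ 1 ⊗ v`. -/
def leftUnitorInv (V : FDBimod k A) : V ⟶ tensor (regular k A) V where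
  toLin := tmul (regular k A) V (1 : A)
  map_left a v := (one_tmul_left V a v).trans
    (congrArg (fun c : A => tmul (regular k A) V c v) (mul_one a).symm)
  map_right _ _ := rfl

/-- `v ↦ v ⊗ 1`. -/
def rightUnitorInv (V : FDBimod k A) : V ⟶ tensor V (regular k A) where
  toLin := (tmul V (regular k A)).flip (1 : A)
  map_left _ _ := rfl
  map_right b v := (right_tmul_one V v b.unop).trans
    (congrArg (fun c : A => tmul V (regular k A) v c) (one_mul b.unop).symm)

/-- Finite-dimensional `A`-`A`-bimodules with tensor product over `A` as composition. -/
@[simps tensorObj tensorUnit whiskerLeft whiskerRight tensorHom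
  associator_hom associator_inv leftUnitor_hom leftUnitor_inv rightUnitor_hom rightUnitor_inv]
instance : MonoidalCategoryStruct (FDBimod k A) where
  tensorObj := tensor
  whiskerLeft V _ _ f := tensorMap (𝟙 V) f
  whiskerRight f W := tensorMap f (𝟙 W)
  tensorHom f g := tensorMap f g
  tensorUnit := regular k A
  associator U V W :=
    { hom := assocHom U V W
      inv := assocInv U V W
      hom_inv_id := tensor_hom_ext₃ fun _ _ _ => rfl
      inv_hom_id := tensor_hom_ext₃' fun _ _ _ => rfl }
  leftUnitor V :=
    { hom := leftUnitorHom V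
      inv := leftUnitorInv V
      hom_inv_id := tensor_hom_ext fun a v => one_tmul_left V a v
      inv_hom_id := hom_ext fun v => LinearMap.congr_fun (map_one V.left) v }
  rightUnitor V :=
    { hom := rightUnitorHom V
      inv := rightUnitorInv V
      hom_inv_id := tensor_hom_ext fun v a => right_tmul_one V v a
      inv_hom_id := hom_ext fun v => LinearMap.congr_fun (map_one V.right) v }

instance : MonoidalCategory (FDBimod k A) where
  tensorHom_def _ _ := tensor_hom_ext fun _ _ => rfl
  id_tensorHom_id _ _ := tensor_hom_ext fun _ _ => rfl
  tensorHom_comp_tensorHom _ _ _ _ := tensor_hom_ext fun _ _ => rfl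
  whiskerLeft_id _ _ := tensor_hom_ext fun _ _ => rfl
  id_whiskerRight _ _ := tensor_hom_ext fun _ _ => rfl
  associator_naturality _ _ _ := tensor_hom_ext₃ fun _ _ _ => rfl
  leftUnitor_naturality f := tensor_hom_ext fun a v => (Hom.map_left f a v).symm
  rightUnitor_naturality f := tensor_hom_ext fun v a => (Hom.map_right f (.op a) v).symm
  pentagon _ _ _ _ := tensor_hom_ext₄ fun _ _ _ _ => rfl
  triangle V W := tensor_hom_ext₃ fun v a w => (tmul_balanced V W v a w).symm

end

end FDBimod

/-! # Cells, good and great 1-morphisms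

A monoidal category is regarded as a 2-category with one object: 1-morphisms are the objects `F`,
the composition `F ∘ G` of 1-morphisms is `F ⊗ G`, and the identity 1-morphism is `𝟙_ C`. A 2-full
2-subcategory is given by the property `P` of belonging to it as a 1-morphism. -/

namespace OneObject

universe v w

variable {C : Type w} [Category.{v} C] [HasZeroMorphisms C] [HasBinaryBiproducts C]

/-- `G` is isomorphic to a direct summand of `F`. -/
def IsSummand (G F : C) : Prop := ∃ Y : C, Nonempty (F ≅ G ⊞ Y)

/-- The additive closure of `S`: the smallest class which contains `S` and the zero objects and is
closed under direct sums and (objects isomorphic to) direct summands. -/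
inductive AddClosure (S : ObjectProperty C) : ObjectProperty C
  | of {X : C} : S X → AddClosure S X
  | zero {X : C} : IsZero X → AddClosure S X
  | biprod {X Y : C} : AddClosure S X → AddClosure S Y → AddClosure S (X ⊞ Y)
  | summand {X Y : C} : AddClosure S X → IsSummand Y X → AddClosure S Y

variable [MonoidalCategory C]

/-- The left preorder `F ≤_L G` in the 2-subcategory `P`: `G` is a direct summand of `H ∘ F` for
some `H` in `P`. -/
def LeftLE (P : ObjectProperty C) (F G : C) : Prop := ∃ H, P H ∧ IsSummand G (H ⊗ F)

/-- The two-sided preorder `F ≤_J G`: `G` is a direct summand of `H₁ ∘ F ∘ H₂` for some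
`H₁`, `H₂`. -/
def TwoSidedLE (F G : C) : Prop := ∃ H₁ H₂, IsSummand G ((H₁ ⊗ F) ⊗ H₂)

/-- The left cell of `F` in the 2-subcategory `P`: all indecomposable 1-morphisms of `P` which are
left equivalent to `F`. -/
def leftCell (P : ObjectProperty C) (F : C) : ObjectProperty C :=
  fun X => P X ∧ Indecomposable X ∧ LeftLE P F X ∧ LeftLE P X F

/-- The class `L` is a left cell of the 2-subcategory `P`. -/
def IsLeftCell (P L : ObjectProperty C) : Prop :=
  ∃ F, P F ∧ Indecomposable F ∧ L = leftCell P F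

/-- In the 2-subcategory `P`, the 1-morphism `G` is good for `L` by means of `φ : G ⟶ 𝟙`: for all
`F` in `L` the 2-morphism `F φ : F ∘ G ⟶ F` is right split. -/
def IsGoodVia (P L : ObjectProperty C) {G : C} (φ : G ⟶ 𝟙_ C) : Prop :=
  P G ∧ ∀ F, L F → ∃ ξ : F ⟶ F ⊗ G, ξ ≫ (F ◁ φ ≫ (ρ_ F).hom) = 𝟙 F

/-- In the 2-subcategory `P`, the 1-morphism `G` is great for `L` by means of `φ : G ⟶ 𝟙`: it is
good for `L` by means of `φ`, and `φ` factors through every `φ' : G' ⟶ 𝟙` by means of which a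
1-morphism `G'` is good for `L`. -/
def IsGreatVia (P L : ObjectProperty C) {G : C} (φ : G ⟶ 𝟙_ C) : Prop :=
  IsGoodVia P L φ ∧
    ∀ (G' : C) (φ' : G' ⟶ 𝟙_ C), IsGoodVia P L φ' → ∃ β : G ⟶ G', φ = β ≫ φ'

end OneObject

/-! # Bimodules over the dual numbers -/

namespace DualBimod

open OneObject
open scoped DualNumber

variable {k : Type u} [Field k]

instance : Module.Finite k k[ε] := inferInstanceAs (Module.Finite k (k × k))

/-- The action of the dual numbers on `V` for which `ε` acts by the square-zero map `e`. -/
def epsAction {V : Type u} [AddCommGroup V] [Module k V] (e : Module.End k V) (he : e * e = 0) :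
    k[ε] →ₐ[k] Module.End k V :=
  DualNumber.lift ⟨(Algebra.ofId k _, e), he, fun a => (Algebra.commutes a e).symm⟩

theorem epsAction_apply {V : Type u} [AddCommGroup V] [Module k V] (e : Module.End k V)
    (he : e * e = 0) (a : k[ε]) (v : V) : epsAction e he a v = a.fst • v + a.snd • e v := by
  simp [epsAction, DualNumber.lift_apply_apply, Algebra.ofId_apply]

/-- The bimodule over the dual numbers on which `ε` acts by `l` from the left and by `r` from the
right. -/
def ofEps {V : Type u} [AddCommGroup V] [Module k V] [Module.Finite k V] (l r : Module.End k V)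
    (hl : l * l = 0) (hr : r * r = 0) (hlr : l * r = r * l) : FDBimod k k[ε] where
  carrier := V
  left := epsAction l hl
  right := (epsAction r hr).comp (AlgEquiv.toOpposite k k[ε]).symm.toAlgHom
  left_right a b v := by
    have h : ∀ u, l (r u) = r (l u) := LinearMap.congr_fun hlr
    simp [epsAction_apply, h, smul_comm _ a.snd, smul_comm _ a.fst]
    abel

/-- Right multiplication by `ε` on the span of `e_0, …, e_{n-1}`: `e_j ↦ e_{j-1}` for `j` odd, and
`e_j ↦ 0` for `j` even. -/
def zigzagRight (k : Type u) [Field k] (n : ℕ) : Module.End k (Fin n → k) :=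
  Matrix.toLin' (Matrix.of fun i j : Fin n => if Odd j.val ∧ i.val + 1 = j.val then 1 else 0)

/-- Left multiplication by `ε` on the span of `e_0, …, e_{n-1}`: `e_j ↦ e_{j+1}` for `j` odd and
`j + 1 < n`, and `e_j ↦ 0` otherwise. -/
def zigzagLeft (k : Type u) [Field k] (n : ℕ) : Module.End k (Fin n → k) :=
  Matrix.toLin' (Matrix.of fun i j : Fin n => if Odd j.val ∧ i.val = j.val + 1 then 1 else 0)

theorem zigzag_mul_eq_zero {n : ℕ} (p q : ℕ → ℕ → Prop) [DecidableRel p] [DecidableRel q]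
    (h : ∀ i j, Odd j → p i j → ¬ Odd i) :
    Matrix.toLin' (Matrix.of fun i j : Fin n =>
      if Odd j.val ∧ q i.val j.val then (1 : k) else 0) *
    Matrix.toLin' (Matrix.of fun i j : Fin n =>
      if Odd j.val ∧ p i.val j.val then (1 : k) else 0) = 0 := by
  rw [Module.End.mul_eq_comp, ← Matrix.toLin'_mul]
  refine (congrArg _ ?_).trans (map_zero Matrix.toLin')
  ext i j
  refine (Matrix.mul_apply ..).trans (Finset.sum_eq_zero fun l _ => ?_)
  simp only [Matrix.of_apply]
  split_ifs with h1 h2 <;> simp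
  exact h _ _ h2.1 h2.2 h1.1

theorem odd_add_one_not {i j : ℕ} (hj : Odd j) (h : i = j + 1) : ¬ Odd i := by
  subst h; simpa using hj.add_one

theorem add_one_odd_not {i j : ℕ} (hj : Odd j) (h : i + 1 = j) : ¬ Odd i := by
  subst h; simpa using Nat.not_odd_iff_even.1 fun hi => Nat.not_odd_iff_even.2 hi.add_one hj

theorem zigzagLeft_sq (n : ℕ) : zigzagLeft k n * zigzagLeft k n = 0 :=
  zigzag_mul_eq_zero (fun i j => i = j + 1) (fun i j => i = j + 1) fun _ _ => odd_add_one_not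

theorem zigzagRight_sq (n : ℕ) : zigzagRight k n * zigzagRight k n = 0 :=
  zigzag_mul_eq_zero (fun i j => i + 1 = j) (fun i j => i + 1 = j) fun _ _ => add_one_odd_not

theorem zigzagLeft_mul_zigzagRight (n : ℕ) : zigzagLeft k n * zigzagRight k n = 0 :=
  zigzag_mul_eq_zero (fun i j => i + 1 = j) (fun i j => i = j + 1) fun _ _ => add_one_odd_not

theorem zigzagRight_mul_zigzagLeft (n : ℕ) : zigzagRight k n * zigzagLeft k n = 0 :=
  zigzag_mul_eq_zero (fun i j => i = j + 1) (fun i j => i + 1 = j) fun _ _ => odd_add_one_not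

/-- The string bimodule of the graph
`e_0 ← e_1 → e_2 ← e_3 → ⋯` with `n` vertices, in which `←` is the right action and `→` is the left
action of `ε`. -/
def zigzag (k : Type u) [Field k] (n : ℕ) : FDBimod k k[ε] :=
  ofEps (zigzagLeft k n) (zigzagRight k n) (zigzagLeft_sq n) (zigzagRight_sq n)
    ((zigzagLeft_mul_zigzagRight n).trans (zigzagRight_mul_zigzagLeft n).symm)

/-- The string bimodule `M_n`, with basis `m_1, …, m_{2n+3}` where `m_j` is `e_{j-1}`. -/
def stringM (k : Type u) [Field k] (n : ℕ) : FDBimod k k[ε] := zigzag k (2 * n + 3)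

/-- The string bimodule `N_n`, with basis `m_1, …, m_{2n+2}` where `m_j` is `e_{j-1}`. -/
def stringN (k : Type u) [Field k] (n : ℕ) : FDBimod k k[ε] := zigzag k (2 * n + 2)

/-- The linear map sending `e_j` to `1` for `j` odd and to `ε` for `j` even. -/
def phiLin (k : Type u) [Field k] (n : ℕ) : (Fin n → k) →ₗ[k] k[ε] :=
  Fintype.linearCombination k fun j : Fin n => if Odd j.val then 1 else ε

@[simp]
theorem phiLin_single (n : ℕ) (j : Fin n) :
    phiLin k n (Pi.single j 1) = if Odd j.val then 1 else ε := by
  simp [phiLin]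

theorem phiLin_zigzagLeft (n : ℕ) (v : Fin (2 * n + 3) → k) :
    phiLin k (2 * n + 3) (zigzagLeft k _ v) = ε * phiLin k (2 * n + 3) v := by
  refine LinearMap.congr_fun (f := phiLin k _ ∘ₗ zigzagLeft k _)
    (g := LinearMap.mulLeft k ε ∘ₗ phiLin k _) ((Pi.basisFun k _).ext fun j => ?_) v
  by_cases hj : Odd j.val
  · have hlt : j.val + 1 < 2 * n + 3 := by obtain ⟨t, ht⟩ := hj; omega
    have : zigzagLeft k (2 * n + 3) (Pi.single j 1) = Pi.single ⟨j.val + 1, hlt⟩ 1 := by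
      ext i
      simp [zigzagLeft, hj, Pi.single_apply, Fin.ext_iff]
    have h' : ¬ Odd (j.val + 1) := by simpa using hj.add_one
    simp [this, hj, h']
  · have : zigzagLeft k (2 * n + 3) (Pi.single j 1) = 0 := by
      ext i
      simp [zigzagLeft, hj]
    simp [this, hj]

theorem phiLin_zigzagRight (n : ℕ) (v : Fin n → k) :
    phiLin k n (zigzagRight k _ v) = phiLin k n v * ε := by
  refine LinearMap.congr_fun (f := phiLin k _ ∘ₗ zigzagRight k _)
    (g := LinearMap.mulRight k ε ∘ₗ phiLin k _) ((Pi.basisFun k _).ext fun j => ?_) v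
  by_cases hj : Odd j.val
  · obtain ⟨t, ht⟩ := id hj
    have hlt : 2 * t < n := by omega
    have : zigzagRight k n (Pi.single j 1) = Pi.single ⟨2 * t, hlt⟩ 1 := by
      ext i
      simp [zigzagRight, Pi.single_apply, Fin.ext_iff, ht]
    simp [this, hj]
  · have : zigzagRight k n (Pi.single j 1) = 0 := by
      ext i
      simp [zigzagRight, hj]
    simp [this, hj]

theorem phiLin_left (n : ℕ) (a : k[ε]) (v : Fin (2 * n + 3) → k) :
    phiLin k _ (epsAction (zigzagLeft k _) (zigzagLeft_sq _) a v) = a * phiLin k _ v := by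
  have h : a = TrivSqZeroExt.inl a.fst + a.snd • (ε : k[ε]) := by
    rw [← DualNumber.inr_eq_smul_eps, TrivSqZeroExt.inl_fst_add_inr_snd_eq]
  rw [epsAction_apply, map_add, map_smul, map_smul, phiLin_zigzagLeft]
  conv_rhs => rw [h, add_mul, TrivSqZeroExt.inl_mul_eq_smul, smul_mul_assoc]

theorem phiLin_right (n : ℕ) (a : k[ε]) (v : Fin n → k) :
    phiLin k _ (epsAction (zigzagRight k _) (zigzagRight_sq _) a v) = phiLin k _ v * a := by
  have h : a = TrivSqZeroExt.inl a.fst + a.snd • (ε : k[ε]) := by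
    rw [← DualNumber.inr_eq_smul_eps, TrivSqZeroExt.inl_fst_add_inr_snd_eq]
  rw [epsAction_apply, map_add, map_smul, map_smul, phiLin_zigzagRight]
  conv_rhs => rw [mul_comm, h, add_mul, TrivSqZeroExt.inl_mul_eq_smul, smul_mul_assoc, mul_comm ε]

/-- The bimodule homomorphism `φ_n : M_n ⟶ D` with `φ_n m_j = 1` for `j` even and `φ_n m_j = ε` for
`j` odd. -/
def phi (k : Type u) [Field k] (n : ℕ) : stringM k n ⟶ 𝟙_ (FDBimod k k[ε]) where
  toLin := phiLin k (2 * n + 3)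
  map_left a v := phiLin_left n a v
  map_right b v := phiLin_right _ b.unop v

/-- The 1-morphisms of the 2-full 2-subcategory `𝒟^(m)` of the 2-category `𝒟` of all
finite-dimensional bimodules over the dual numbers: the additive closure of the identity and of the
indecomposable 1-morphisms in the two-sided cells `𝒥 ≥_J 𝒥_m`, where `𝒥_m` is the two-sided cell
of `M_m`. -/
def subcat (k : Type u) [Field k] (m : ℕ) : ObjectProperty (FDBimod k k[ε]) :=
  AddClosure fun G => G = 𝟙_ _ ∨ (Indecomposable G ∧ TwoSidedLE (stringM k m) G)

/-- The class `{N_n, M_n}` of 1-morphisms, up to isomorphism. -/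
def pairNM (k : Type u) [Field k] (n : ℕ) : ObjectProperty (FDBimod k k[ε]) :=
  fun F => Nonempty (F ≅ stringN k n) ∨ Nonempty (F ≅ stringM k n)

end DualBimod

/-! Write `e_j` for the vertices of a string, so that the odd ones generate and `x e_c = e_{c+2} x`
for `c` odd.

Good: the diagonal `e_c ↦ e_c ⊗ e_c` (`c` odd) respects this relation, since `x e_c ⊗ e_c = e_{c+2}
x ⊗ e_c = e_{c+2} ⊗ e_c' x` with `e_c' = e_{c+2}`. It therefore defines a homomorphism from a string
into its product with `M_k`, and as `φ_k` is `1` on odd vertices, this map splits `F φ_k` for `F =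
N_k` and `F = M_k` (`rightSplit_zigzag`).

Great: `N_k` is free as a right module on `e_1, e_3, …, e_{2k+1}`. If `ξ` splits `N_k φ'`, let `g_i`
in `G'` be the coefficient of `e_{2i+1}` in `ξ(e_{2i+1})`. Then `φ'(g_i) = 1` and `x g_i = g_{i+1}
x`, which are the defining relations of `M_k` apart from the two ends. There `x g_0 x` and `x g_k x`
vanish because `k ≥ 1`. So `e_{2i+1} ↦ g_i` is a homomorphism `β` with `φ_k = β ≫ φ'`
(`phi_eq_factor_comp`). Only `N_k ∈ L` matters here (`isGreatVia_phi`).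

Cells: shifting the diagonal by `2s` in the left factor exhibits short strings as summands of
products of longer ones (`isSummand_zigzag`). This gives membership in the subcategory and the left
equivalence of `N_k` and `M_k`. Splitness of `F φ` is inherited along `≤_L`
(`rightSplit_of_leftLE`), so it spreads from `M_k` to the whole left cell. -/

namespace FDBimod

variable {k A : Type u} [Field k] [Ring A] [Algebra k A]

/-! ### Kernels, and splitting of idempotents for bimodules. -/

/-- The kernel of a bimodule homomorphism. -/
def kernel {V W : FDBimod k A} (f : V ⟶ W) : FDBimod k A where
  carrier := LinearMap.ker (Hom.toLin f)
  left :=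
    { toFun := fun a => (V.left a).restrict fun v hv => by
        simp only [LinearMap.mem_ker] at hv ⊢
        rw [Hom.map_left, hv, map_zero]
      map_one' := by ext; simp
      map_mul' := fun a b => by ext; simp
      map_zero' := by ext; simp
      map_add' := fun a b => by ext; simp
      commutes' := fun r => by ext; simp [AlgHom.commutes] }
  right :=
    { toFun := fun a => (V.right a).restrict fun v hv => by
        simp only [LinearMap.mem_ker] at hv ⊢
        rw [Hom.map_right, hv, map_zero]
      map_one' := by ext; simp
      map_mul' := fun a b => by ext; simp
      map_zero' := by ext; simp
      map_add' := fun a b => by ext; simp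
      commutes' := fun r => by
        ext
        simp only [LinearMap.coe_restrict_apply]
        rw [AlgHom.commutes V.right]
        rfl }
  left_right a b v := Subtype.ext (V.left_right a b v)

/-- The inclusion of the kernel. -/
def kernelHom {V W : FDBimod k A} (f : V ⟶ W) : kernel f ⟶ V where
  toLin := (LinearMap.ker (Hom.toLin f)).subtype
  map_left _ _ := rfl
  map_right _ _ := rfl

/-- The factorization through the kernel. -/
def kernelLift {U V W : FDBimod k A} (f : V ⟶ W) (g : U ⟶ V) (h : g ≫ f = 0) :
    U ⟶ kernel f where
  toLin := (Hom.toLin g).codRestrict _ fun u =>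
    LinearMap.congr_fun (congrArg Hom.toLin h) u
  map_left a u := Subtype.ext (Hom.map_left g a u)
  map_right a u := Subtype.ext (Hom.map_right g a u)

theorem kernelHom_comp {V W : FDBimod k A} (f : V ⟶ W) : kernelHom f ≫ f = 0 :=
  hom_ext fun v => v.2

theorem kernelLift_comp {U V W : FDBimod k A} (f : V ⟶ W) (g : U ⟶ V) (h : g ≫ f = 0) :
    kernelLift f g h ≫ kernelHom f = g := rfl

theorem kernelHom_mono {U V W : FDBimod k A} (f : V ⟶ W) {g h : U ⟶ kernel f}
    (e : g ≫ kernelHom f = h ≫ kernelHom f) : g = h :=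
  hom_ext fun u => Subtype.ext (LinearMap.congr_fun (congrArg Hom.toLin e) u)

/-- A retract of a bimodule is a direct summand. -/
theorem isSummand_of_retract {V W : FDBimod k A} (s : W ⟶ V) (p : V ⟶ W) (h : s ≫ p = 𝟙 W) :
    OneObject.IsSummand W V := by
  -- The complement of `W` is the kernel of `p`, and `𝟙 V - p ≫ s` is the projection onto it.
  have hz : (𝟙 V - p ≫ s) ≫ p = 0 := by simp [Preadditive.sub_comp, h]
  let b : BinaryBicone W (kernel p) :=
    { pt := V
      fst := p
      snd := kernelLift p (𝟙 V - p ≫ s) hz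
      inl := s
      inr := kernelHom p
      inl_fst := h
      inl_snd := kernelHom_mono p (by
        simp [kernelLift_comp, Preadditive.comp_sub, reassoc_of% h])
      inr_fst := kernelHom_comp p
      inr_snd := kernelHom_mono p (by
        simp [kernelLift_comp, Preadditive.comp_sub, reassoc_of% kernelHom_comp p]) }
  exact ⟨kernel p, ⟨biprod.uniqueUpToIso _ _ (isBinaryBilimitOfTotal b (by
    simp [b, kernelLift_comp]))⟩⟩

end FDBimod

/-! ### Split 2-morphisms, summands and indecomposability in a monoidal category. -/

namespace OneObject

universe v w

variable {C : Type w} [Category.{v} C]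

section

variable [MonoidalCategory C]

/-- Conjugate the section by the retraction: the interchange law and naturality of `ρ` carry `p`
past `F φ`. -/
theorem rightSplit_of_retract {F G X : C} {φ : G ⟶ 𝟙_ C} (s : X ⟶ F) (p : F ⟶ X) (h : s ≫ p = 𝟙 X)
    (hF : ∃ ξ : F ⟶ F ⊗ G, ξ ≫ (F ◁ φ ≫ (ρ_ F).hom) = 𝟙 F) :
    ∃ ξ : X ⟶ X ⊗ G, ξ ≫ (X ◁ φ ≫ (ρ_ X).hom) = 𝟙 X := by
  obtain ⟨ξ, hξ⟩ := hF
  refine ⟨s ≫ ξ ≫ p ▷ G, ?_⟩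
  have : p ▷ G ≫ X ◁ φ ≫ (ρ_ X).hom = (F ◁ φ ≫ (ρ_ F).hom) ≫ p := by
    rw [← whisker_exchange_assoc]; simp
  rw [Category.assoc, Category.assoc, this, ← Category.assoc ξ, hξ, Category.id_comp, h]

/-- `φ` acts on the right of `F`, so composing with `H` on the left does not disturb the section. -/
theorem rightSplit_tensor {F G : C} {φ : G ⟶ 𝟙_ C} (H : C)
    (hF : ∃ ξ : F ⟶ F ⊗ G, ξ ≫ (F ◁ φ ≫ (ρ_ F).hom) = 𝟙 F) :
    ∃ ξ : H ⊗ F ⟶ (H ⊗ F) ⊗ G, ξ ≫ ((H ⊗ F) ◁ φ ≫ (ρ_ (H ⊗ F)).hom) = 𝟙 (H ⊗ F) := by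
  obtain ⟨ξ, hξ⟩ := hF
  refine ⟨H ◁ ξ ≫ (α_ H F G).inv, ?_⟩
  have : (α_ H F G).inv ≫ (H ⊗ F) ◁ φ ≫ (ρ_ (H ⊗ F)).hom = H ◁ (F ◁ φ ≫ (ρ_ F).hom) := by
    simp
  rw [Category.assoc, this, ← whiskerLeft_comp, hξ, whiskerLeft_id]

end

/-- A decomposition `X ≅ Y ⊞ Z` yields the idempotent projecting to `Y`. If it is `0` then `Y`
vanishes; if it is `𝟙 X` then `Z` does. -/
theorem indecomposable_of_idem [Preadditive C] [HasBinaryBiproducts C] {X : C} (h0 : ¬ IsZero X)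
    (h : ∀ f : X ⟶ X, f ≫ f = f → f = 0 ∨ f = 𝟙 X) : Indecomposable X := by
  refine ⟨h0, fun Y Z a => ?_⟩
  rcases h (a.hom ≫ biprod.fst ≫ biprod.inl ≫ a.inv) (by simp) with hf | hf
  · left
    rw [IsZero.iff_id_eq_zero]
    calc 𝟙 Y = (biprod.inl ≫ a.inv) ≫ (a.hom ≫ biprod.fst ≫ biprod.inl ≫ a.inv) ≫
          (a.hom ≫ biprod.fst) := by simp
      _ = 0 := by rw [hf]; simp
  · right
    rw [IsZero.iff_id_eq_zero]
    calc 𝟙 Z = (biprod.inr ≫ a.inv) ≫ 𝟙 X ≫ (a.hom ≫ biprod.snd) := by simp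
      _ = 0 := by rw [← hf]; simp

variable [HasZeroMorphisms C] [HasBinaryBiproducts C]

theorem IsSummand.exists_retract {G F : C} (h : IsSummand G F) :
    ∃ (s : G ⟶ F) (p : F ⟶ G), s ≫ p = 𝟙 G := by
  obtain ⟨Y, ⟨e⟩⟩ := h
  exact ⟨biprod.inl ≫ e.inv, e.hom ≫ biprod.fst, by simp⟩

theorem IsSummand.congr {G F F' : C} (h : IsSummand G F) (e : F ≅ F') : IsSummand G F' := by
  obtain ⟨Y, ⟨a⟩⟩ := h
  exact ⟨Y, ⟨e.symm ≪≫ a⟩⟩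

variable [MonoidalCategory C]

theorem rightSplit_of_leftLE {P : ObjectProperty C} {F G X : C} {φ : G ⟶ 𝟙_ C}
    (h : LeftLE P F X) (hF : ∃ ξ : F ⟶ F ⊗ G, ξ ≫ (F ◁ φ ≫ (ρ_ F).hom) = 𝟙 F) :
    ∃ ξ : X ⟶ X ⊗ G, ξ ≫ (X ◁ φ ≫ (ρ_ X).hom) = 𝟙 X := by
  obtain ⟨H, -, hs⟩ := h
  obtain ⟨s, p, hsp⟩ := hs.exists_retract
  exact rightSplit_of_retract s p hsp (rightSplit_tensor H hF)

end OneObject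

/-! ### Bimodules over the dual numbers as spaces with two commuting square-zero operators. -/

namespace DualBimod

open OneObject FDBimod
open scoped DualNumber

variable {k : Type u} [Field k]

/-- The left action of `ε`. -/
def epsL (V : FDBimod k k[ε]) : V →ₗ[k] V := V.left ε

/-- The right action of `ε`. -/
def epsR (V : FDBimod k k[ε]) : V →ₗ[k] V := V.right (.op ε)

theorem dual_eq (a : k[ε]) : a = algebraMap k k[ε] a.fst + a.snd • (ε : k[ε]) := by
  rw [← DualNumber.inr_eq_smul_eps]
  exact (TrivSqZeroExt.inl_fst_add_inr_snd_eq a).symm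

theorem left_eq (V : FDBimod k k[ε]) (a : k[ε]) (v : V) :
    V.left a v = a.fst • v + a.snd • epsL V v := by
  conv_lhs => rw [dual_eq a, map_add, AlgHom.commutes, map_smul]
  rfl

theorem right_eq (V : FDBimod k k[ε]) (a : k[ε]) (v : V) :
    V.right (.op a) v = a.fst • v + a.snd • epsR V v := by
  have : MulOpposite.op a = algebraMap k k[ε]ᵐᵒᵖ a.fst + a.snd • MulOpposite.op (ε : k[ε]) := by
    conv_lhs => rw [dual_eq a]
    rfl
  rw [this, map_add, AlgHom.commutes, map_smul]
  rfl

theorem epsL_epsL (V : FDBimod k k[ε]) (v : V) : epsL V (epsL V v) = 0 := by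
  have := LinearMap.congr_fun (map_mul V.left (ε : k[ε]) ε) v
  rw [DualNumber.eps_mul_eps, map_zero] at this
  exact this.symm

theorem epsR_epsR (V : FDBimod k k[ε]) (v : V) : epsR V (epsR V v) = 0 := by
  have := LinearMap.congr_fun (map_mul V.right (.op (ε : k[ε])) (.op ε)) v
  rw [← MulOpposite.op_mul, DualNumber.eps_mul_eps, MulOpposite.op_zero, map_zero] at this
  exact this.symm

theorem epsL_epsR (V : FDBimod k k[ε]) (v : V) : epsL V (epsR V v) = epsR V (epsL V v) :=
  V.left_right _ _ v

theorem hom_epsL {V W : FDBimod k k[ε]} (f : V ⟶ W) (v : V) :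
    Hom.toLin f (epsL V v) = epsL W (Hom.toLin f v) := Hom.map_left f _ v

theorem hom_epsR {V W : FDBimod k k[ε]} (f : V ⟶ W) (v : V) :
    Hom.toLin f (epsR V v) = epsR W (Hom.toLin f v) := Hom.map_right f _ v

/-- A linear map commuting with both actions of `ε` is a bimodule homomorphism. -/
def homOfEps {V W : FDBimod k k[ε]} (f : V →ₗ[k] W) (hl : ∀ v, f (epsL V v) = epsL W (f v))
    (hr : ∀ v, f (epsR V v) = epsR W (f v)) : V ⟶ W where
  toLin := f
  map_left a v := by rw [left_eq, left_eq]; simp [hl]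
  map_right a v := by
    obtain ⟨a, rfl⟩ := MulOpposite.op_surjective a
    rw [right_eq, right_eq]; simp [hr]

theorem balanced_of_eps {V W : FDBimod k k[ε]} {Z : Type u} [AddCommGroup Z] [Module k Z]
    (f : V →ₗ[k] W →ₗ[k] Z) (h : ∀ v w, f (epsR V v) w = f v (epsL W w)) (v : V) (a : k[ε])
    (w : W) : f (V.right (.op a) v) w = f v (W.left a w) := by
  rw [left_eq, right_eq]; simp [h]

@[simp]
theorem epsL_tmul (V W : FDBimod k k[ε]) (v : V) (w : W) :
    epsL (tensor V W) (tmul V W v w) = tmul V W (epsL V v) w := rfl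

@[simp]
theorem epsR_tmul (V W : FDBimod k k[ε]) (v : V) (w : W) :
    epsR (tensor V W) (tmul V W v w) = tmul V W v (epsR W w) := rfl

theorem epsR_tmul_balanced (V W : FDBimod k k[ε]) (v : V) (w : W) :
    tmul V W (epsR V v) w = tmul V W v (epsL W w) := tmul_balanced V W v ε w

/-! ## Coordinates on string bimodules -/

/-- The basis vector `e_i`, which is zero for `i ≥ n`. -/
def vec (k : Type u) [Field k] (n i : ℕ) : zigzag k n :=
  fun j : Fin n => if j.val = i then (1 : k) else 0

/-- The coordinate at `e_i`, which is zero for `i ≥ n`. -/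
def coordFun (k : Type u) [Field k] (n i : ℕ) : (Fin n → k) →ₗ[k] k :=
  if h : i < n then LinearMap.proj ⟨i, h⟩ else 0

theorem coordFun_lt {n i : ℕ} (h : i < n) (v : Fin n → k) : coordFun k n i v = v ⟨i, h⟩ := by
  simp [coordFun, h]

theorem coordFun_ge {n i : ℕ} (h : n ≤ i) (v : Fin n → k) : coordFun k n i v = 0 := by
  simp [coordFun, h.not_gt]

/-- The coordinate at `e_i` as a linear map on the string bimodule. -/
def coord (k : Type u) [Field k] (n i : ℕ) : zigzag k n →ₗ[k] k := coordFun k n i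

theorem coord_lt {n i : ℕ} (h : i < n) (v : zigzag k n) :
    coord k n i v = (v : Fin n → k) ⟨i, h⟩ := coordFun_lt h v

theorem coord_ge {n i : ℕ} (h : n ≤ i) (v : zigzag k n) : coord k n i v = 0 := coordFun_ge h v

theorem vec_ge {n i : ℕ} (h : n ≤ i) : vec k n i = 0 :=
  funext fun j : Fin n => if_neg (by omega)

theorem coord_vec {n i j : ℕ} (h : i < n) : coord k n j (vec k n i) = if j = i then 1 else 0 := by
  by_cases hj : j < n
  · rw [coord_lt hj]; rfl
  · rw [coord_ge (by omega), if_neg (by omega)]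

theorem ext_coord {n : ℕ} {v w : zigzag k n} (h : ∀ i < n, coord k n i v = coord k n i w) :
    v = w :=
  funext fun j : Fin n => by
    have := h j j.2
    rwa [coord_lt j.2, coord_lt j.2] at this

/-- The basis of a string bimodule. -/
noncomputable def zigzagBasis (k : Type u) [Field k] (n : ℕ) :
    Module.Basis (Fin n) k (zigzag k n) :=
  Pi.basisFun k (Fin n)

theorem zigzagBasis_apply {n : ℕ} (j : Fin n) : zigzagBasis k n j = vec k n j :=
  (Pi.basisFun_apply k (Fin n) j).trans (funext fun i => by simp [vec, Pi.single_apply, Fin.ext_iff])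

theorem zigzagBasis_repr {n : ℕ} (j : Fin n) (v : zigzag k n) :
    (zigzagBasis k n).repr v j = coord k n j v := by
  rw [coord_lt j.2]; exact Pi.basisFun_repr (R := k) (η := Fin n) v j

theorem zigzag_hom_ext {n : ℕ} {Z : Type u} [AddCommGroup Z] [Module k Z]
    {f g : zigzag k n →ₗ[k] Z} (h : ∀ i < n, f (vec k n i) = g (vec k n i)) : f = g :=
  (zigzagBasis k n).ext fun j => by rw [zigzagBasis_apply]; exact h j j.2

/-- The linear map with prescribed values on the basis vectors. -/
noncomputable def zlift {n : ℕ} {Z : Type u} [AddCommGroup Z] [Module k Z] (b : ℕ → Z) :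
    zigzag k n →ₗ[k] Z :=
  (zigzagBasis k n).constr k fun j => b j

theorem zlift_vec {n : ℕ} {Z : Type u} [AddCommGroup Z] [Module k Z] (b : ℕ → Z) {i : ℕ}
    (h : i < n) : zlift b (vec k n i) = b i := by
  have := (zigzagBasis k n).constr_basis k (fun j => b j) ⟨i, h⟩
  rwa [zigzagBasis_apply] at this

theorem zigzagLeft_single {n : ℕ} (i : Fin n) :
    zigzagLeft k n (Pi.single i 1) =
      fun j : Fin n => if Odd i.val ∧ j.val = i.val + 1 then (1 : k) else 0 := by
  ext j
  simp [zigzagLeft]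

theorem zigzagRight_single {n : ℕ} (i : Fin n) :
    zigzagRight k n (Pi.single i 1) =
      fun j : Fin n => if Odd i.val ∧ j.val + 1 = i.val then (1 : k) else 0 := by
  ext j
  simp [zigzagRight]

theorem single_eq_vec {n : ℕ} (i : Fin n) :
    (Pi.single i 1 : Fin n → k) = fun j : Fin n => if j.val = i.val then (1 : k) else 0 :=
  funext fun j => by simp [Pi.single_apply, Fin.ext_iff]

theorem epsL_vec {n i : ℕ} (h : i < n) :
    epsL (zigzag k n) (vec k n i) =
      fun j : Fin n => if Odd i ∧ j.val = i + 1 then (1 : k) else 0 := by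
  have h1 := epsAction_apply (zigzagLeft k n) (zigzagLeft_sq n) ε (Pi.single ⟨i, h⟩ 1)
  rw [DualNumber.fst_eps, DualNumber.snd_eps, zero_smul, zero_add, one_smul,
    zigzagLeft_single, single_eq_vec] at h1
  exact h1

theorem epsR_vec {n i : ℕ} (h : i < n) :
    epsR (zigzag k n) (vec k n i) =
      fun j : Fin n => if Odd i ∧ j.val + 1 = i then (1 : k) else 0 := by
  have h1 := epsAction_apply (zigzagRight k n) (zigzagRight_sq n) ε (Pi.single ⟨i, h⟩ 1)
  rw [DualNumber.fst_eps, DualNumber.snd_eps, zero_smul, zero_add, one_smul,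
    zigzagRight_single, single_eq_vec] at h1
  exact h1

theorem epsL_vec_odd {n i : ℕ} (hi : Odd i) :
    epsL (zigzag k n) (vec k n i) = vec k n (i + 1) := by
  rcases lt_or_ge i n with h | h
  · rw [epsL_vec h]
    exact funext fun j : Fin n => by simp [hi, vec]
  · rw [vec_ge h, vec_ge (by omega), map_zero]

theorem epsL_vec_even {n i : ℕ} (hi : Even i) : epsL (zigzag k n) (vec k n i) = 0 := by
  rcases lt_or_ge i n with h | h
  · rw [epsL_vec h]
    exact funext fun j : Fin n => if_neg fun h => Nat.not_odd_iff_even.2 hi h.1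
  · rw [vec_ge h, map_zero]

/-- The bound is genuine: if `i + 1 = n`, the left side is zero and `e_i` is not. At the right end
the convention `vec = 0` suits only the left action, so `epsL_vec_odd` needs no bound. -/
theorem epsR_vec_odd {n i : ℕ} (hi : Even i) (h : i + 1 < n) :
    epsR (zigzag k n) (vec k n (i + 1)) = vec k n i := by
  rw [epsR_vec h]
  exact funext fun j : Fin n => by simp [hi.add_one, vec]

theorem epsR_vec_even {n i : ℕ} (hi : Even i) : epsR (zigzag k n) (vec k n i) = 0 := by
  rcases lt_or_ge i n with h | h
  · rw [epsR_vec h]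
    exact funext fun j : Fin n => if_neg fun h => Nat.not_odd_iff_even.2 hi h.1
  · rw [vec_ge h, map_zero]

theorem coord_epsL_odd {n i : ℕ} (hi : Odd i) (v : zigzag k n) :
    coord k n i (epsL _ v) = 0 := by
  refine LinearMap.congr_fun (f := coord k n i ∘ₗ epsL _) (g := 0)
    (zigzag_hom_ext fun j hj => ?_) v
  rcases Nat.even_or_odd j with h | h
  · simp [epsL_vec_even h]
  · rw [LinearMap.comp_apply, epsL_vec_odd h]
    rcases lt_or_ge (j + 1) n with h' | h'
    · rw [coord_vec h', if_neg (by grind), LinearMap.zero_apply]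
    · rw [vec_ge h', map_zero, LinearMap.zero_apply]

theorem coord_epsL_zero {n : ℕ} (v : zigzag k n) : coord k n 0 (epsL _ v) = 0 := by
  refine LinearMap.congr_fun (f := coord k n 0 ∘ₗ epsL _) (g := 0)
    (zigzag_hom_ext fun j hj => ?_) v
  rcases Nat.even_or_odd j with h | h
  · simp [epsL_vec_even h]
  · rw [LinearMap.comp_apply, epsL_vec_odd h]
    rcases lt_or_ge (j + 1) n with h' | h'
    · rw [coord_vec h', if_neg (by grind), LinearMap.zero_apply]
    · rw [vec_ge h', map_zero, LinearMap.zero_apply]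

/-- Dually to the vectors, it is now the left action that needs a bound: coordinate `i + 1` vanishes
out of range while coordinate `i` may not. -/
theorem coord_epsL_even {n i : ℕ} (hi : Odd i) (h : i + 1 < n) (v : zigzag k n) :
    coord k n (i + 1) (epsL _ v) = coord k n i v := by
  refine LinearMap.congr_fun (f := coord k n (i + 1) ∘ₗ epsL _) (g := coord k n i)
    (zigzag_hom_ext fun j hj => ?_) v
  rw [coord_vec hj]
  rcases Nat.even_or_odd j with h' | h'
  · rw [LinearMap.comp_apply, epsL_vec_even h', map_zero, if_neg (by grind)]
  · rw [LinearMap.comp_apply, epsL_vec_odd h']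
    rcases lt_or_ge (j + 1) n with h'' | h''
    · simp [coord_vec h'']
    · rw [vec_ge h'', map_zero, if_neg (by omega)]

theorem coord_epsR_odd {n i : ℕ} (hi : Odd i) (v : zigzag k n) :
    coord k n i (epsR _ v) = 0 := by
  refine LinearMap.congr_fun (f := coord k n i ∘ₗ epsR _) (g := 0)
    (zigzag_hom_ext fun j hj => ?_) v
  rcases Nat.even_or_odd j with h | ⟨j, rfl⟩
  · simp [epsR_vec_even h]
  · rw [LinearMap.comp_apply, epsR_vec_odd (even_two_mul j) hj, coord_vec (by omega),
      if_neg (by grind), LinearMap.zero_apply]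

theorem coord_epsR_even {n i : ℕ} (hi : Even i) (v : zigzag k n) :
    coord k n i (epsR _ v) = coord k n (i + 1) v := by
  refine LinearMap.congr_fun (f := coord k n i ∘ₗ epsR _) (g := coord k n (i + 1))
    (zigzag_hom_ext fun j hj => ?_) v
  rw [coord_vec hj]
  rcases Nat.even_or_odd j with h' | ⟨j, rfl⟩
  · rw [LinearMap.comp_apply, epsR_vec_even h', map_zero, if_neg (by grind)]
  · rw [LinearMap.comp_apply, epsR_vec_odd (even_two_mul j) hj, coord_vec (by omega)]
    simp

/-! ## String bimodules are indecomposable -/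

theorem vec_ne_zero {n i : ℕ} (h : i < n) : vec k n i ≠ 0 := fun h0 => by
  have := congrArg (coord k n i) h0
  simp [coord_vec h] at this

theorem not_isZero_zigzag {n : ℕ} (hn : 0 < n) : ¬ IsZero (zigzag k n) := fun h => by
  rw [IsZero.iff_id_eq_zero] at h
  exact vec_ne_zero hn (LinearMap.congr_fun (congrArg Hom.toLin h) (vec k n 0))

/-- Neighbouring vertices are joined by an arrow with which `f` commutes, so their diagonal entries
agree. By connectedness of the string, the diagonal of `f` is constant. -/
theorem coord_hom_vec_succ {n : ℕ} (f : zigzag k n ⟶ zigzag k n) {i : ℕ} (h : i + 1 < n) :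
    coord k n (i + 1) (Hom.toLin f (vec k n (i + 1))) = coord k n i (Hom.toLin f (vec k n i)) := by
  rcases Nat.even_or_odd i with hi | hi
  · conv_rhs => rw [← epsR_vec_odd hi h, hom_epsR, coord_epsR_even hi]
  · rw [← epsL_vec_odd hi, hom_epsL, coord_epsL_even hi h]

theorem coord_hom_vec {n : ℕ} (f : zigzag k n ⟶ zigzag k n) {i : ℕ} (h : i < n) :
    coord k n i (Hom.toLin f (vec k n i)) = coord k n 0 (Hom.toLin f (vec k n 0)) := by
  induction i with
  | zero => rfl
  | succ i ih => rw [coord_hom_vec_succ f h, ih (by omega)]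

/-- Row 1 of the matrix of `f` is zero off the diagonal: even vertices lie in the image of an action
of `ε`, and such images have no odd coordinates. This row makes the diagonal scalar multiplicative.
-/
theorem coord_one_hom {n : ℕ} (hn : 1 < n) (f : zigzag k n ⟶ zigzag k n) (v : zigzag k n) :
    coord k n 1 (Hom.toLin f v) = coord k n 0 (Hom.toLin f (vec k n 0)) * coord k n 1 v := by
  refine LinearMap.congr_fun (f := coord k n 1 ∘ₗ Hom.toLin f)
    (g := coord k n 0 (Hom.toLin f (vec k n 0)) • coord k n 1) (zigzag_hom_ext fun i hi => ?_) v
  rw [LinearMap.comp_apply, LinearMap.smul_apply, coord_vec hi, smul_eq_mul]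
  rcases Nat.even_or_odd i with h | ⟨j, rfl⟩
  · rw [if_neg (by grind), mul_zero]
    rcases Nat.eq_zero_or_pos i with rfl | h0
    · rw [← epsR_vec_odd h hn, hom_epsR, coord_epsR_odd odd_one]
    · obtain ⟨j, rfl⟩ : ∃ j, i = j + 1 := ⟨i - 1, by omega⟩
      rw [← epsL_vec_odd (by grind), hom_epsL, coord_epsL_odd odd_one]
  · rcases Nat.eq_zero_or_pos j with rfl | h0
    · simpa using coord_hom_vec f hn
    · obtain ⟨j, rfl⟩ : ∃ i, j = i + 1 := ⟨j - 1, by omega⟩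
      -- For odd `c ≥ 3`, the entry is coordinate 0 of `f(e_c) x = f(e_{c-1}) = x f(e_{c-2})`, and
      -- no left multiple of `x` involves `e_0`.
      rw [if_neg (by omega), mul_zero, ← zero_add 1, ← coord_epsR_even Even.zero, ← hom_epsR,
        epsR_vec_odd (even_two_mul _) hi, show 2 * (j + 1) = 2 * j + 1 + 1 by ring,
        ← epsL_vec_odd (odd_two_mul_add_one j), hom_epsL, coord_epsL_zero]

theorem trace_hom {n : ℕ} (f : zigzag k n ⟶ zigzag k n) :
    LinearMap.trace k _ (Hom.toLin f) = n * coord k n 0 (Hom.toLin f (vec k n 0)) := by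
  rw [LinearMap.trace_eq_matrix_trace k (zigzagBasis k n), Matrix.trace,
    Finset.sum_congr rfl fun j _ => ?_, Finset.sum_const, Finset.card_fin, nsmul_eq_mul]
  rw [Matrix.diag_apply, LinearMap.toMatrix_apply, zigzagBasis_repr, zigzagBasis_apply,
    coord_hom_vec f j.2]

/-- In characteristic 0 the trace of an idempotent detects its rank, and here the trace is `n` times
the diagonal scalar. -/
theorem eq_zero_of_idem [CharZero k] {n : ℕ} (f : zigzag k n ⟶ zigzag k n) (hf : f ≫ f = f)
    (h : coord k n 0 (Hom.toLin f (vec k n 0)) = 0) : f = 0 := by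
  have h1 : IsIdempotentElem (Hom.toLin f) := congrArg Hom.toLin hf
  exact Hom.ext (LinearMap.IsIdempotentElem.eq_zero_of_trace_eq_zero h1 (by
    rw [trace_hom, h, mul_zero]))

/-- The diagonal scalar of an idempotent satisfies `λ² = λ`, by row 1 applied to `f(f(e_1)) =
f(e_1)`. If `λ = 0` then `f = 0`; if `λ = 1`, the same applies to `𝟙 - f`. -/
theorem indecomposable_zigzag [CharZero k] {n : ℕ} (hn : 1 < n) :
    Indecomposable (zigzag k n) := by
  refine indecomposable_of_idem (not_isZero_zigzag (by omega)) fun f hf => ?_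
  have h1 := coord_hom_vec f hn
  have h2 := coord_one_hom hn f (Hom.toLin f (vec k n 1))
  have h3 : Hom.toLin f (Hom.toLin f (vec k n 1)) = Hom.toLin f (vec k n 1) :=
    LinearMap.congr_fun (congrArg Hom.toLin hf) _
  rw [h3, h1] at h2
  rcases eq_or_ne (coord k n 0 (Hom.toLin f (vec k n 0))) 0 with h | h
  · exact Or.inl (eq_zero_of_idem f hf h)
  · right
    have h4 : coord k n 0 (Hom.toLin f (vec k n 0)) = 1 := by
      field_simp at h2; exact h2.symm
    refine (sub_eq_zero.1 (eq_zero_of_idem (𝟙 _ - f) ?_ ?_)).symm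
    · simp [Preadditive.sub_comp, Preadditive.comp_sub, hf]
    · have : Hom.toLin (𝟙 (zigzag k n) - f) (vec k n 0) = vec k n 0 - Hom.toLin f (vec k n 0) := by
        rw [sub_eq_add_neg, sub_eq_add_neg]; rfl
      rw [this, map_sub, h4, coord_vec (by omega), if_pos rfl, sub_self]

/-! ## Tensor products of string bimodules -/

/-- Coordinates of the projection of a product of string bimodules to a string on its diagonal. -/
def diagCoord {n q : ℕ} (s : ℕ) (v : zigzag k n) (w : zigzag k q) (c : ℕ) : k :=
  if Odd c then coord k n (c + 2 * s) v * coord k q c w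
  else coord k n (c + 1 + 2 * s) v * coord k q c w +
    if c = 0 then 0 else coord k n (c + 2 * s) v * coord k q (c - 1) w

theorem diagCoord_odd {n q : ℕ} (s : ℕ) (v : zigzag k n) (w : zigzag k q) {c : ℕ} (hc : Odd c) :
    diagCoord s v w c = coord k n (c + 2 * s) v * coord k q c w := if_pos hc

theorem diagCoord_zero {n q : ℕ} (s : ℕ) (v : zigzag k n) (w : zigzag k q) :
    diagCoord s v w 0 = coord k n (1 + 2 * s) v * coord k q 0 w := by
  simp [diagCoord]

theorem diagCoord_even {n q : ℕ} (s : ℕ) (v : zigzag k n) (w : zigzag k q) {c : ℕ} (hc : Odd c) :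
    diagCoord s v w (c + 1) = coord k n (c + 2 + 2 * s) v * coord k q (c + 1) w +
      coord k n (c + 1 + 2 * s) v * coord k q c w := by
  rw [diagCoord, if_neg (by grind), if_neg (by omega), Nat.add_sub_cancel]

/-- The bilinear map with coordinates `diagCoord`. -/
def diagFun (k : Type u) [Field k] (n q s p : ℕ) :
    zigzag k n →ₗ[k] zigzag k q →ₗ[k] (Fin p → k) :=
  LinearMap.mk₂ k (fun v w c => diagCoord s v w c)
    (fun _ _ _ => by ext; simp only [diagCoord, map_add, Pi.add_apply]; split_ifs <;> ring)
    (fun _ _ _ => by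
      ext; simp only [diagCoord, map_smul, Pi.smul_apply, smul_eq_mul]; split_ifs <;> ring)
    (fun _ _ _ => by ext; simp only [diagCoord, map_add, Pi.add_apply]; split_ifs <;> ring)
    (fun _ _ _ => by
      ext; simp only [diagCoord, map_smul, Pi.smul_apply, smul_eq_mul]; split_ifs <;> ring)

/-- The projection of a product of string bimodules to a string on its diagonal, as a bilinear
map. -/
def diagBil (k : Type u) [Field k] (n q s p : ℕ) :
    zigzag k n →ₗ[k] zigzag k q →ₗ[k] zigzag k p := diagFun k n q s p

theorem coord_diagBil {n q s p i : ℕ} (h : i < p) (v : zigzag k n) (w : zigzag k q) :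
    coord k p i (diagBil k n q s p v w) = diagCoord s v w i := coord_lt h _

@[elab_as_elim]
theorem zero_odd_even_cases {motive : ℕ → Prop} (c : ℕ) (h0 : motive 0) (ho : ∀ c, Odd c → motive c)
    (he : ∀ c, Odd c → motive (c + 1)) : motive c := by
  rcases Nat.even_or_odd c with h | h
  · rcases Nat.eq_zero_or_pos c with rfl | h'
    · exact h0
    · obtain ⟨c, rfl⟩ : ∃ j, c = j + 1 := ⟨c - 1, by omega⟩
      exact he c (by grind)
  · exact ho c h

section Diagonal

variable {p q s : ℕ}

/-- This is why even coordinates `c > 0` of `diagCoord` have two terms: `e_{c+2s} ⊗ e_{c-1} =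
e_{c+1+2s} x ⊗ e_{c-1}` equals `e_{c+1+2s} ⊗ e_c` when these vertices exist, so both representatives
must be detected. For `c = 0` there is only one. -/
theorem diagBil_balanced (hq : p ≤ q + 1) (v : zigzag k (p + 2 * s)) (w : zigzag k q) :
    diagBil k _ q s p (epsR _ v) w = diagBil k _ q s p v (epsL _ w) := by
  refine ext_coord fun c hc => ?_
  rw [coord_diagBil hc, coord_diagBil hc]
  induction c using zero_odd_even_cases with
  | h0 =>
    rw [diagCoord_zero, diagCoord_zero, coord_epsL_zero, coord_epsR_odd (by grind)]; ring
  | ho c h =>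
    rw [diagCoord_odd _ _ _ h, diagCoord_odd _ _ _ h, coord_epsL_odd h,
      coord_epsR_odd (by grind)]; ring
  | he c h =>
    rw [diagCoord_even _ _ _ h, diagCoord_even _ _ _ h, coord_epsL_odd h,
      coord_epsR_odd (by grind), coord_epsR_even (by grind),
      show c + 1 + 2 * s + 1 = c + 2 + 2 * s by ring]
    rcases lt_or_ge (c + 2) p with h' | h'
    · rw [coord_epsL_even h (by omega)]; ring
    -- The string ends at `e_{c+1}`, and the left factor has no vertex `c + 2 + 2 * s`.
    · rw [coord_ge (i := c + 2 + 2 * s) (by omega)]; ring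

theorem diagBil_left (v : zigzag k (p + 2 * s)) (w : zigzag k q) :
    diagBil k _ q s p (epsL _ v) w = epsL _ (diagBil k _ q s p v w) := by
  refine ext_coord fun c hc => ?_
  rw [coord_diagBil hc]
  induction c using zero_odd_even_cases with
  | h0 =>
    rw [diagCoord_zero, coord_epsL_zero, coord_epsL_odd (by grind)]; ring
  | ho c h =>
    rw [diagCoord_odd _ _ _ h, coord_epsL_odd h, coord_epsL_odd (by grind)]; ring
  | he c h =>
    rw [diagCoord_even _ _ _ h, coord_epsL_odd (by grind), coord_epsL_even h hc,
      coord_diagBil (by omega), diagCoord_odd _ _ _ h, show c + 1 + 2 * s = c + 2 * s + 1 by ring,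
      coord_epsL_even (by grind) (by omega)]; ring

theorem diagBil_right (v : zigzag k (p + 2 * s)) (w : zigzag k q) :
    diagBil k _ q s p v (epsR _ w) = epsR _ (diagBil k _ q s p v w) := by
  have key (c : ℕ) (h : Even c) : coord k p c (epsR _ (diagBil k _ q s p v w)) =
      coord k _ (c + 1 + 2 * s) v * coord k _ (c + 1) w := by
    rw [coord_epsR_even h]
    rcases lt_or_ge (c + 1) p with h' | h'
    · rw [coord_diagBil h', diagCoord_odd _ _ _ h.add_one]
    · rw [coord_ge h', coord_ge (by omega), zero_mul]
  refine ext_coord fun c hc => ?_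
  rw [coord_diagBil hc]
  induction c using zero_odd_even_cases with
  | h0 =>
    rw [diagCoord_zero, key 0 Even.zero, coord_epsR_even Even.zero, zero_add]
  | ho c h =>
    rw [diagCoord_odd _ _ _ h, coord_epsR_odd h, coord_epsR_odd h, mul_zero]
  | he c h =>
    rw [diagCoord_even _ _ _ h, key _ (by grind), coord_epsR_even (by grind), coord_epsR_odd h,
      show c + 1 + 1 + 2 * s = c + 2 + 2 * s by ring]; ring

/-- The projection of a product of string bimodules to a string on its diagonal. -/
def diagProj (k : Type u) [Field k] {p q : ℕ} (s : ℕ) (hq : p ≤ q + 1) :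
    zigzag k (p + 2 * s) ⊗ zigzag k q ⟶ zigzag k p :=
  homOfEps (V := tensor (zigzag k (p + 2 * s)) (zigzag k q))
    (tlift (diagBil k _ q s p) (balanced_of_eps _ (diagBil_balanced hq)))
    (LinearMap.congr_fun (g := epsL _ ∘ₗ tlift _ _)
      (f := tlift (diagBil k _ q s p) (balanced_of_eps _ (diagBil_balanced hq)) ∘ₗ epsL _)
      (tensor_ext fun v w => diagBil_left v w))
    (LinearMap.congr_fun (g := epsR _ ∘ₗ tlift _ _)
      (f := tlift (diagBil k _ q s p) (balanced_of_eps _ (diagBil_balanced hq)) ∘ₗ epsR _)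
      (tensor_ext fun v w => diagBil_right v w))

theorem diagProj_tmul (s : ℕ) (hq : p ≤ q + 1) (v : zigzag k (p + 2 * s)) (w : zigzag k q) :
    Hom.toLin (diagProj k s hq) (tmul _ _ v w) = diagBil k _ q s p v w := rfl

/-- The images of the basis vectors under `diagIncl`. -/
def diagVec (k : Type u) [Field k] (n q s c : ℕ) : tensor (zigzag k n) (zigzag k q) :=
  if Odd c then tmul _ _ (vec k n (c + 2 * s)) (vec k q c)
  else if c = 0 then tmul _ _ (vec k n (1 + 2 * s)) (vec k q 0)
  else tmul _ _ (vec k n (c + 2 * s)) (vec k q (c - 1))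

theorem diagVec_odd {n q s c : ℕ} (hc : Odd c) :
    diagVec k n q s c = tmul _ _ (vec k n (c + 2 * s)) (vec k q c) := if_pos hc

theorem diagVec_zero {n q s : ℕ} :
    diagVec k n q s 0 = tmul _ _ (vec k n (1 + 2 * s)) (vec k q 0) := by
  simp [diagVec]

theorem diagVec_even {n q s c : ℕ} (hc : Odd c) :
    diagVec k n q s (c + 1) = tmul _ _ (vec k n (c + 1 + 2 * s)) (vec k q c) := by
  rw [diagVec, if_neg (by grind), if_neg (by omega), Nat.add_sub_cancel]

/-- The inclusion of a string on the diagonal of a product of string bimodules. -/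
noncomputable def diagIncl (k : Type u) [Field k] {p q : ℕ} (s : ℕ) (hp : 4 ≤ p)
    (hq : ∀ c, Odd c → c < p → c < q) : zigzag k p ⟶ zigzag k (p + 2 * s) ⊗ zigzag k q :=
  homOfEps (W := tensor (zigzag k (p + 2 * s)) (zigzag k q)) (zlift (diagVec k _ q s))
    (LinearMap.congr_fun (f := zlift (diagVec k _ q s) ∘ₗ epsL _)
      (g := epsL _ ∘ₗ zlift (diagVec k _ q s)) (zigzag_hom_ext fun c hc => by
        rw [LinearMap.comp_apply, LinearMap.comp_apply, zlift_vec _ hc]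
        induction c using zero_odd_even_cases with
        | h0 =>
          -- `x e_{1+2s} ⊗ e_0 = e_{3+2s} x ⊗ e_0 = e_{3+2s} ⊗ x e_0 = 0`; the vertex `e_{3+2s}`
          -- exists because `4 ≤ p`.
          rw [epsL_vec_even Even.zero, map_zero, diagVec_zero, epsL_tmul,
            epsL_vec_odd (by grind), ← epsR_vec_odd (by grind) (by omega), epsR_tmul_balanced,
            epsL_vec_even Even.zero, map_zero]
        | ho c h =>
          rw [epsL_vec_odd h, diagVec_odd h, epsL_tmul, epsL_vec_odd (by grind)]
          rcases lt_or_ge (c + 1) p with h' | h'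
          · rw [zlift_vec _ h', diagVec_even h, show c + 1 + 2 * s = c + 2 * s + 1 by ring]
          · rw [vec_ge h', vec_ge (by omega), map_zero, map_zero, LinearMap.zero_apply]
        | he c h =>
          rw [epsL_vec_even (by grind), diagVec_even h, epsL_tmul, epsL_vec_even (by grind),
            map_zero, map_zero, LinearMap.zero_apply]))
    (LinearMap.congr_fun (f := zlift (diagVec k _ q s) ∘ₗ epsR _)
      (g := epsR _ ∘ₗ zlift (diagVec k _ q s)) (zigzag_hom_ext fun c hc => by
        rw [LinearMap.comp_apply, LinearMap.comp_apply, zlift_vec _ hc]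
        induction c using zero_odd_even_cases with
        | h0 =>
          rw [epsR_vec_even Even.zero, map_zero, diagVec_zero, epsR_tmul,
            epsR_vec_even Even.zero, map_zero]
        | ho c h =>
          rw [diagVec_odd h, epsR_tmul]
          have h1 := hq c h hc
          obtain ⟨j, rfl⟩ := h
          rw [epsR_vec_odd (even_two_mul j) hc, epsR_vec_odd (even_two_mul j) h1,
            zlift_vec _ (by omega)]
          rcases Nat.eq_zero_or_pos j with rfl | h0
          · rw [mul_zero, zero_add, diagVec_zero]
          · obtain ⟨j, rfl⟩ : ∃ i, j = i + 1 := ⟨j - 1, by omega⟩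
            have h2 : Odd (2 * j + 1) := odd_two_mul_add_one j
            -- With `d = 2j + 1`: `e_{d+2+2s} ⊗ e_{d+1} = e_{d+2+2s} x ⊗ e_d = e_{d+1+2s} ⊗ e_d`,
            -- the chosen image of `e_{d+1}`.
            rw [show 2 * (j + 1) = 2 * j + 1 + 1 by ring, diagVec_even h2, ← epsL_vec_odd h2,
              ← epsR_tmul_balanced, show 2 * j + 1 + 1 + 1 + 2 * s = 2 * j + 1 + 1 + 2 * s + 1 by ring,
              epsR_vec_odd (by grind) (by omega)]
        | he c h =>
          rw [epsR_vec_even (by grind), map_zero, diagVec_even h, epsR_tmul]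
          have h1 := hq c h (by omega)
          obtain ⟨j, rfl⟩ := h
          rw [epsR_vec_odd (even_two_mul j) h1]
          rcases Nat.eq_zero_or_pos j with rfl | h0
          -- Again `e_{2+2s} ⊗ e_0 = e_{3+2s} ⊗ x e_0 = 0`. For larger `c` the right factor is a
          -- left multiple of `x`, which moves across and kills the even vertex on the left.
          · rw [← epsR_vec_odd (by grind) (by omega), epsR_tmul_balanced,
              epsL_vec_even (by grind), map_zero]
          · obtain ⟨j, rfl⟩ : ∃ i, j = i + 1 := ⟨j - 1, by omega⟩
            rw [show 2 * (j + 1) = 2 * j + 1 + 1 by ring, ← epsL_vec_odd (odd_two_mul_add_one j),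
              ← epsR_tmul_balanced, epsR_vec_even (by grind), map_zero, LinearMap.zero_apply]))

theorem diagIncl_vec (s : ℕ) (hp : 4 ≤ p) (hq : ∀ c, Odd c → c < p → c < q) {c : ℕ} (hc : c < p) :
    Hom.toLin (diagIncl k s hp hq) (vec k p c) = diagVec k _ q s c := zlift_vec _ hc

/-- Each `diagVec` is a pure tensor of basis vectors, met by exactly one term of exactly one
`diagCoord`. -/
theorem diagIncl_diagProj (s : ℕ) (hp : 4 ≤ p) (hq : ∀ c, Odd c → c < p → c < q)
    (hq' : p ≤ q + 1) : diagIncl k s hp hq ≫ diagProj k s hq' = 𝟙 _ := by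
  refine Hom.ext (zigzag_hom_ext fun c hc => ?_)
  rw [comp_toLin, LinearMap.comp_apply, diagIncl_vec s hp hq hc, id_toLin, LinearMap.id_apply]
  refine ext_coord fun i hi => ?_
  induction c using zero_odd_even_cases with
  | h0 =>
    rw [diagVec_zero, diagProj_tmul, coord_vec (by omega)]
    rw [coord_diagBil hi]
    induction i using zero_odd_even_cases with
    | h0 =>
      rw [diagCoord_zero, coord_vec (by omega), coord_vec (by have := hq 1; grind)]; simp
    | ho i h' =>
      rw [diagCoord_odd _ _ _ h', coord_vec (by omega), coord_vec (by have := hq 1; grind)]; grind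
    | he i h' =>
      rw [diagCoord_even _ _ _ h', coord_vec (by omega), coord_vec (by have := hq 1; grind),
        coord_vec (by omega), coord_vec (by have := hq 1; grind)]; grind
  | ho c h =>
    have h1 := hq c h hc
    rw [diagVec_odd h, diagProj_tmul, coord_vec (by omega)]
    rw [coord_diagBil hi]
    induction i using zero_odd_even_cases with
    | h0 =>
      rw [diagCoord_zero, coord_vec (by omega), coord_vec (by omega)]; grind
    | ho i h' =>
      rw [diagCoord_odd _ _ _ h', coord_vec (by omega), coord_vec (by omega)]; grind
    | he i h' =>
      rw [diagCoord_even _ _ _ h', coord_vec (by omega), coord_vec (by omega),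
        coord_vec (by omega), coord_vec (by omega)]; grind
  | he c h =>
    have h1 := hq c h (by omega)
    rw [diagVec_even h, diagProj_tmul, coord_vec (by omega)]
    rw [coord_diagBil hi]
    induction i using zero_odd_even_cases with
    | h0 =>
      rw [diagCoord_zero, coord_vec (by omega), coord_vec (by omega)]; grind
    | ho i h' =>
      rw [diagCoord_odd _ _ _ h', coord_vec (by omega), coord_vec (by omega)]; grind
    | he i h' =>
      rw [diagCoord_even _ _ _ h', coord_vec (by omega), coord_vec (by omega),
        coord_vec (by omega), coord_vec (by omega)]; grind

end Diagonal

/-! ## The homomorphism `phi` splits -/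

theorem phi_vec_odd {n c : ℕ} (h : Odd c) (hc : c < 2 * n + 3) :
    Hom.toLin (phi k n) (vec k _ c) = (1 : k[ε]) := by
  have := phiLin_single (k := k) (2 * n + 3) ⟨c, hc⟩
  rw [if_pos h, single_eq_vec] at this
  exact this

theorem phi_vec_even {n c : ℕ} (h : Even c) (hc : c < 2 * n + 3) :
    Hom.toLin (phi k n) (vec k _ c) = (ε : k[ε]) := by
  have := phiLin_single (k := k) (2 * n + 3) ⟨c, hc⟩
  rw [if_neg (Nat.not_odd_iff_even.2 h), single_eq_vec] at this
  exact this

theorem whiskerLeft_rho_tmul {F G : FDBimod k k[ε]} (φ : G ⟶ 𝟙_ (FDBimod k k[ε])) (v : F) (g : G) :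
    Hom.toLin (F ◁ φ ≫ (ρ_ F).hom) (tmul F G v g) =
      F.right (.op (show k[ε] from Hom.toLin φ g)) v := rfl

theorem right_one (V : FDBimod k k[ε]) (v : V) : V.right (.op (1 : k[ε])) v = v :=
  LinearMap.congr_fun (map_one V.right) v

/-- The unshifted diagonal inclusion is the section. Every image `e_a ⊗ e_c` with `c` odd goes to
`e_a φ(e_c) = e_a`, and the remaining `e_1 ⊗ e_0` goes to `e_1 ε = e_0`. -/
theorem rightSplit_zigzag {n p : ℕ} (hp : 4 ≤ p) (hq : ∀ c, Odd c → c < p → c < 2 * n + 3)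
    (hp' : p ≤ 2 * n + 3) :
    ∃ ξ : zigzag k p ⟶ zigzag k p ⊗ stringM k n,
      ξ ≫ (zigzag k p ◁ phi k n ≫ (ρ_ (zigzag k p)).hom) = 𝟙 _ := by
  refine ⟨diagIncl k (q := 2 * n + 3) 0 hp hq, Hom.ext (zigzag_hom_ext fun c hc => ?_)⟩
  let g : tensor (zigzag k p) (stringM k n) ⟶ zigzag k p :=
    zigzag k p ◁ phi k n ≫ (ρ_ (zigzag k p)).hom
  suffices h : Hom.toLin g (diagVec k p (2 * n + 3) 0 c) = vec k p c from
    (congrArg (Hom.toLin g) (diagIncl_vec 0 hp hq hc)).trans h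
  have key (a b : ℕ) : Hom.toLin g (tmul _ (zigzag k (2 * n + 3)) (vec k p a) (vec k _ b)) =
      (zigzag k p).right (.op (show k[ε] from Hom.toLin (phi k n) (vec k (2 * n + 3) b)))
        (vec k p a) := rfl
  induction c using zero_odd_even_cases with
  | h0 =>
    refine (congrArg (Hom.toLin g) diagVec_zero).trans ((key _ _).trans ?_)
    rw [phi_vec_even Even.zero (by omega)]
    exact epsR_vec_odd (i := 0) Even.zero (by omega)
  | ho c h =>
    refine (congrArg (Hom.toLin g) (diagVec_odd h)).trans ((key _ _).trans ?_)
    rw [phi_vec_odd h (by omega)]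
    exact right_one _ _
  | he c h =>
    refine (congrArg (Hom.toLin g) (diagVec_even h)).trans ((key _ _).trans ?_)
    rw [phi_vec_odd h (by omega)]
    exact right_one _ _

/-! ## Factorization of `phi` -/

section Component

variable {p : ℕ} {G : FDBimod k k[ε]}

/-- The bilinear map defining `component`. -/
def componentBil (k : Type u) [Field k] (p : ℕ) (G : FDBimod k k[ε]) (i : ℕ) :
    zigzag k p →ₗ[k] G →ₗ[k] G :=
  LinearMap.mk₂ k (fun v g => coord k p (2 * i + 1) v • g + coord k p (2 * i) v • epsL G g)
    (fun _ _ _ => by simp only [map_add, add_smul]; abel)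
    (fun _ _ _ => by simp only [map_smul, smul_eq_mul, mul_smul, smul_add])
    (fun _ _ _ => by simp only [map_add, smul_add]; abel)
    (fun c v g => by
      simp only [map_smul, smul_add]
      rw [smul_comm _ c g, smul_comm _ c (epsL G g)])

theorem componentBil_apply (i : ℕ) (v : zigzag k p) (g : G) :
    componentBil k p G i v g =
      coord k p (2 * i + 1) v • g + coord k p (2 * i) v • epsL G g := rfl

/-- The coefficient in `G` of `e_{2i+1}`, for the right module basis `e_1, e_3, …` of the string
bimodule. -/
def component (k : Type u) [Field k] (p : ℕ) (G : FDBimod k k[ε]) (i : ℕ) :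
    tensor (zigzag k p) G →ₗ[k] G :=
  tlift (componentBil k p G i) (balanced_of_eps _ fun v g => by
    rw [componentBil_apply, componentBil_apply, coord_epsR_odd (odd_two_mul_add_one i),
      coord_epsR_even (even_two_mul i), epsL_epsL, zero_smul, zero_add, smul_zero, add_zero])

theorem component_tmul (i : ℕ) (v : zigzag k p) (g : G) :
    component k p G i (tmul _ _ v g) =
      coord k p (2 * i + 1) v • g + coord k p (2 * i) v • epsL G g := rfl

theorem component_epsR (i : ℕ) (t : tensor (zigzag k p) G) :
    component k p G i (epsR _ t) = epsR G (component k p G i t) :=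
  LinearMap.congr_fun (f := component k p G i ∘ₗ epsR _) (g := epsR G ∘ₗ component k p G i)
    (tensor_ext fun v g => by
      rw [LinearMap.comp_apply, LinearMap.comp_apply, epsR_tmul, component_tmul, component_tmul,
        map_add, map_smul, map_smul, epsL_epsR]) t

/-- From `x e_{2i+1} ⊗ g = e_{2i+3} x ⊗ g = e_{2i+3} ⊗ x g`: left multiplication by `x` shifts the
component by one and acts on the coefficient. -/
theorem component_epsL {i : ℕ} (hi : 2 * i + 2 < p) (t : tensor (zigzag k p) G) :
    component k p G (i + 1) (epsL _ t) = epsL G (component k p G i t) :=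
  LinearMap.congr_fun (f := component k p G (i + 1) ∘ₗ epsL _) (g := epsL G ∘ₗ component k p G i)
    (tensor_ext fun v g => by
      rw [LinearMap.comp_apply, LinearMap.comp_apply, epsL_tmul, component_tmul, component_tmul,
        map_add, map_smul, map_smul, epsL_epsL, coord_epsL_odd (odd_two_mul_add_one _),
        show 2 * (i + 1) = 2 * i + 1 + 1 by ring,
        coord_epsL_even (odd_two_mul_add_one _) hi, smul_zero, zero_smul, zero_add, add_zero]) t

/-- The right side is the element of the dual numbers by which `e_{2i+1}` is multiplied in the image
of `t`, as `e_{2i+1} (a + b ε) = a e_{2i+1} + b e_{2i}`. So taking components is natural in `G`. -/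
theorem phi_component {φ : G ⟶ 𝟙_ (FDBimod k k[ε])} (i : ℕ) (t : tensor (zigzag k p) G) :
    (Hom.toLin φ (component k p G i t) : k[ε]) =
      coord k p (2 * i + 1) (Hom.toLin (zigzag k p ◁ φ ≫ (ρ_ (zigzag k p)).hom) t) • (1 : k[ε]) +
      coord k p (2 * i) (Hom.toLin (zigzag k p ◁ φ ≫ (ρ_ (zigzag k p)).hom) t) • (ε : k[ε]) := by
  let h : zigzag k p →ₗ[k] k[ε] :=
    (coord k p (2 * i + 1)).smulRight 1 + (coord k p (2 * i)).smulRight ε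
  let φ' : G →ₗ[k] k[ε] := Hom.toLin φ
  refine LinearMap.congr_fun (f := φ' ∘ₗ component k p G i)
    (g := h ∘ₗ Hom.toLin (zigzag k p ◁ φ ≫ (ρ_ (zigzag k p)).hom))
    (tensor_ext fun v g => ?_) t
  have h1 : φ' (epsL G g) = ε * φ' g := hom_epsL φ g
  have h2 := whiskerLeft_rho_tmul φ v g
  rw [right_eq] at h2
  rw [LinearMap.comp_apply, LinearMap.comp_apply, component_tmul]
  refine Eq.trans ?_ (congrArg h h2).symm
  change _ = coord k p (2 * i + 1) ((φ' g).fst • v + (φ' g).snd • epsR _ v) • (1 : k[ε]) +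
    coord k p (2 * i) ((φ' g).fst • v + (φ' g).snd • epsR _ v) • (ε : k[ε])
  rw [map_add, map_smul, map_smul, h1, map_add, map_smul, map_smul, map_add, map_smul, map_smul,
    coord_epsR_odd (odd_two_mul_add_one i), coord_epsR_even (even_two_mul i)]
  ext <;> simp [mul_comm, add_comm]

end Component

section Factor

variable {n : ℕ} {G : FDBimod k k[ε]} (ξ : zigzag k (2 * n + 2) ⟶ zigzag k (2 * n + 2) ⊗ G)

/-- The diagonal coefficients of a homomorphism from `N_n` to `N_n ⊗ G`. -/
def diagCoeff (i : ℕ) : G := component k (2 * n + 2) G i (Hom.toLin ξ (vec k _ (2 * i + 1)))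

/-- Compare component `i + 1` of `ξ` on the two sides of `x e_{2i+1} = e_{2i+3} x`. -/
theorem epsL_diagCoeff {i : ℕ} (hi : i < n) :
    epsL G (diagCoeff ξ i) = epsR G (diagCoeff ξ (i + 1)) := by
  rw [diagCoeff, diagCoeff, ← component_epsR, ← component_epsL (by omega)]
  refine congrArg (component k (2 * n + 2) G (i + 1)) ?_
  refine (hom_epsL ξ _).symm.trans (Eq.trans ?_ (hom_epsR ξ _))
  rw [epsL_vec_odd (odd_two_mul_add_one i), epsR_vec_odd (even_two_mul _) (by omega)]
  rfl

/-- With `g_i` the diagonal coefficients, `x g_i x = g_{i+1} x² = 0` for `i < n`, and `x g_n x = x²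
g_{n-1} = 0` at the end. A neighbour exists in each case because `n ≥ 1`. -/
theorem epsR_epsL_diagCoeff (hn : 1 ≤ n) {i : ℕ} (hi : i ≤ n) :
    epsR G (epsL G (diagCoeff ξ i)) = 0 := by
  rcases hi.lt_or_eq with h | rfl
  · rw [epsL_diagCoeff ξ h, epsR_epsR]
  · obtain ⟨j, rfl⟩ : ∃ j, i = j + 1 := ⟨i - 1, by omega⟩
    rw [← epsL_epsR, ← epsL_diagCoeff ξ (Nat.lt_succ_self j), epsL_epsL]

/-- The images of the basis vectors under `factor`. -/
def factorVec (c : ℕ) : G :=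
  if Odd c then diagCoeff ξ (c / 2)
  else if c = 0 then epsR G (diagCoeff ξ 0)
  else epsL G (diagCoeff ξ ((c - 1) / 2))

theorem factorVec_zero : factorVec ξ 0 = epsR G (diagCoeff ξ 0) := by simp [factorVec]

theorem factorVec_odd (i : ℕ) : factorVec ξ (2 * i + 1) = diagCoeff ξ i := by
  rw [factorVec, if_pos (odd_two_mul_add_one i), show (2 * i + 1) / 2 = i by omega]

theorem factorVec_even (i : ℕ) : factorVec ξ (2 * i + 1 + 1) = epsL G (diagCoeff ξ i) := by
  rw [factorVec, if_neg (by grind), if_neg (by omega), show (2 * i + 1 + 1 - 1) / 2 = i by omega]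

/-- The homomorphism from `M_n` to `G` given by the diagonal coefficients. -/
noncomputable def factor (hn : 1 ≤ n) : stringM k n ⟶ G :=
  homOfEps (V := zigzag k (2 * n + 3)) (zlift (factorVec ξ))
    (LinearMap.congr_fun (f := zlift (factorVec ξ) ∘ₗ epsL _)
      (g := epsL _ ∘ₗ zlift (factorVec ξ)) (zigzag_hom_ext fun c hc => by
        rw [LinearMap.comp_apply, LinearMap.comp_apply, zlift_vec _ hc]
        induction c using zero_odd_even_cases with
        | h0 =>
          rw [epsL_vec_even Even.zero, map_zero, factorVec_zero, epsL_epsR,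
            epsR_epsL_diagCoeff ξ hn (by omega)]
        | ho c h =>
          obtain ⟨j, rfl⟩ := h
          rw [epsL_vec_odd (odd_two_mul_add_one j), zlift_vec _ (by omega), factorVec_even,
            factorVec_odd]
        | he c h =>
          rw [epsL_vec_even (by grind), map_zero]
          obtain ⟨j, rfl⟩ := h
          rw [factorVec_even, epsL_epsL]))
    (LinearMap.congr_fun (f := zlift (factorVec ξ) ∘ₗ epsR _)
      (g := epsR _ ∘ₗ zlift (factorVec ξ)) (zigzag_hom_ext fun c hc => by
        rw [LinearMap.comp_apply, LinearMap.comp_apply, zlift_vec _ hc]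
        induction c using zero_odd_even_cases with
        | h0 => rw [epsR_vec_even Even.zero, map_zero, factorVec_zero, epsR_epsR]
        | ho c h =>
          obtain ⟨j, rfl⟩ := h
          rw [epsR_vec_odd (even_two_mul j) hc, zlift_vec _ (by omega), factorVec_odd]
          rcases Nat.eq_zero_or_pos j with rfl | h0
          · rw [mul_zero, factorVec_zero]
          · obtain ⟨j, rfl⟩ : ∃ i, j = i + 1 := ⟨j - 1, by omega⟩
            rw [← epsL_diagCoeff ξ (by omega), show 2 * (j + 1) = 2 * j + 1 + 1 by ring,
              factorVec_even]
        | he c h =>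
          rw [epsR_vec_even (by grind), map_zero]
          obtain ⟨j, rfl⟩ := h
          -- This includes the last vertex `e_{2n+2}`, present in `M_n` but not in `N_n`.
          rw [factorVec_even, epsR_epsL_diagCoeff ξ hn (by omega)]))

theorem factor_vec (hn : 1 ≤ n) {c : ℕ} (hc : c < 2 * n + 3) :
    Hom.toLin (factor ξ hn) (vec k _ c) = factorVec ξ c := zlift_vec _ hc

variable {φ : G ⟶ 𝟙_ (FDBimod k k[ε])}

/-- `N_n φ` sends `ξ(e_{2i+1})` back to `e_{2i+1}`, whose coordinates at `2i+1` and `2i` are `1` and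
`0`. -/
theorem phi_diagCoeff
    (hξ : ξ ≫ (zigzag k (2 * n + 2) ◁ φ ≫ (ρ_ (zigzag k (2 * n + 2))).hom) = 𝟙 _)
    {i : ℕ} (hi : i ≤ n) : Hom.toLin φ (diagCoeff ξ i) = (1 : k[ε]) := by
  have h : Hom.toLin (zigzag k (2 * n + 2) ◁ φ ≫ (ρ_ (zigzag k (2 * n + 2))).hom)
      (Hom.toLin ξ (vec k (2 * n + 2) (2 * i + 1))) = vec k _ (2 * i + 1) :=
    LinearMap.congr_fun (congrArg Hom.toLin hξ) _
  refine (phi_component i _).trans ?_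
  rw [h, coord_vec (by omega), coord_vec (by omega), if_pos rfl, if_neg (by omega), one_smul,
    zero_smul]
  exact add_zero (1 : k[ε])

theorem phi_eq_factor_comp (hn : 1 ≤ n)
    (hξ : ξ ≫ (zigzag k (2 * n + 2) ◁ φ ≫ (ρ_ (zigzag k (2 * n + 2))).hom) = 𝟙 _) :
    phi k n = factor ξ hn ≫ φ := by
  refine Hom.ext (zigzag_hom_ext fun c hc => ?_)
  refine Eq.trans ?_ (congrArg (Hom.toLin φ) (factor_vec ξ hn hc)).symm
  induction c using zero_odd_even_cases with
  | h0 =>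
    refine (phi_vec_even Even.zero hc).trans ?_
    rw [factorVec_zero, hom_epsR, phi_diagCoeff ξ hξ (by omega)]
    exact (one_mul (ε : k[ε])).symm
  | ho c h =>
    refine (phi_vec_odd h hc).trans ?_
    obtain ⟨j, rfl⟩ := h
    rw [factorVec_odd, phi_diagCoeff ξ hξ (by omega)]
  | he c h =>
    refine (phi_vec_even (by grind) hc).trans ?_
    obtain ⟨j, rfl⟩ := h
    rw [factorVec_even, hom_epsL, phi_diagCoeff ξ hξ (by omega)]
    exact (mul_one (ε : k[ε])).symm

end Factor

/-! ## Cells -/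

theorem isSummand_zigzag {p q : ℕ} (s : ℕ) (hp : 4 ≤ p) (hq : ∀ c, Odd c → c < p → c < q)
    (hq' : p ≤ q + 1) : IsSummand (zigzag k p) (zigzag k (p + 2 * s) ⊗ zigzag k q) :=
  isSummand_of_retract _ _ (diagIncl_diagProj s hp hq hq')

/-- `M_n` is a shifted diagonal in `M_m ⊗ N_m`. The shift is even, so the left factor must have the
parity of the string; for `N_n` the product is therefore `N_m ⊗ M_m`. -/
theorem subcat_stringM [CharZero k] {m n : ℕ} (hn : 1 ≤ n) (hnm : n ≤ m) :
    subcat k m (stringM k n) := by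
  obtain ⟨s, rfl⟩ := Nat.exists_eq_add_of_le hnm
  refine .of (Or.inr ⟨indecomposable_zigzag (by omega), 𝟙_ _, stringN k (n + s), ?_⟩)
  refine IsSummand.congr (isSummand_zigzag (q := 2 * (n + s) + 2) s (by omega)
    (fun c h hc => by grind) (by omega)) ?_
  rw [show 2 * n + 3 + 2 * s = 2 * (n + s) + 3 by ring]
  exact whiskerRightIso (λ_ (stringM k (n + s))).symm (stringN k (n + s))

theorem subcat_stringN [CharZero k] {m n : ℕ} (hn : 1 ≤ n) (hnm : n ≤ m) :
    subcat k m (stringN k n) := by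
  obtain ⟨s, rfl⟩ := Nat.exists_eq_add_of_le hnm
  refine .of (Or.inr ⟨indecomposable_zigzag (by omega), stringN k (n + s), 𝟙_ _, ?_⟩)
  refine IsSummand.congr (isSummand_zigzag (q := 2 * (n + s) + 3) s (by omega)
    (fun c h hc => by omega) (by omega)) ?_
  rw [show 2 * n + 2 + 2 * s = 2 * (n + s) + 2 by ring]
  exact (ρ_ (stringN k (n + s) ⊗ stringM k (n + s))).symm

theorem isGreatVia_phi [CharZero k] {m n : ℕ} (hn : 1 ≤ n) (hnm : n ≤ m)
    {L : ObjectProperty (FDBimod k k[ε])} (hN : L (stringN k n))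
    (hL : ∀ X, L X → ∃ ξ : X ⟶ X ⊗ stringM k n, ξ ≫ (X ◁ phi k n ≫ (ρ_ X).hom) = 𝟙 X) :
    IsGreatVia (subcat k m) L (phi k n) := by
  refine ⟨⟨subcat_stringM hn hnm, hL⟩, fun G φ hG => ?_⟩
  obtain ⟨ξ, hξ⟩ := hG.2 _ hN
  exact ⟨factor ξ hn, phi_eq_factor_comp ξ hn hξ⟩

end DualBimod

/-! ### Greatness for the pair and for its left cell. -/

open DualBimod OneObject in
theorem mainTheorem5 (k : Type u) [Field k] [IsAlgClosed k] [CharZero k] (m n : ℕ)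
    (hn : 1 ≤ n) (hnm : n ≤ m) :
    OneObject.IsGreatVia (DualBimod.subcat k m) (DualBimod.pairNM k n) (DualBimod.phi k n) ∧
    ∃ L : ObjectProperty (FDBimod k (DualNumber k)),
      OneObject.IsLeftCell (DualBimod.subcat k m) L ∧
      L (DualBimod.stringN k n) ∧ L (DualBimod.stringM k n) ∧
      OneObject.IsGreatVia (DualBimod.subcat k m) L (DualBimod.phi k n) := by
  have sM := rightSplit_zigzag (k := k) (n := n) (p := 2 * n + 3) (by omega) (by omega) le_rfl
  have sN := rightSplit_zigzag (k := k) (n := n) (p := 2 * n + 2) (by omega) (by omega) (by omega)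
  have pM := subcat_stringM (k := k) hn hnm
  have pN := subcat_stringN (k := k) hn hnm
  have iM : Indecomposable (stringM k n) := indecomposable_zigzag (by omega)
  have iN : Indecomposable (stringN k n) := indecomposable_zigzag (by omega)
  -- The right factor `N_n` may be one vertex shorter than `M_n`, since the diagonal only needs the
  -- odd vertices of `M_n` there.
  have hNM : LeftLE (subcat k m) (stringN k n) (stringM k n) :=
    ⟨stringM k n, pM, isSummand_zigzag 0 (by omega) (fun c h hc => by grind) (by omega)⟩
  have hMN : LeftLE (subcat k m) (stringM k n) (stringN k n) :=
    ⟨stringN k n, pN, isSummand_zigzag 0 (by omega) (fun c h hc => by omega) (by omega)⟩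
  have hMM : LeftLE (subcat k m) (stringM k n) (stringM k n) :=
    ⟨stringM k n, pM, isSummand_zigzag 0 (by omega) (fun c h hc => by omega) (by omega)⟩
  refine ⟨isGreatVia_phi hn hnm (Or.inl ⟨Iso.refl _⟩) ?_, leftCell (subcat k m) (stringM k n),
    ⟨_, pM, iM, rfl⟩, ⟨pN, iN, hMN, hNM⟩, ⟨pM, iM, hMM, hMM⟩,
    isGreatVia_phi hn hnm ⟨pN, iN, hMN, hNM⟩ fun X hX => rightSplit_of_leftLE hX.2.2.1 sM⟩
  rintro X (⟨⟨e⟩⟩ | ⟨⟨e⟩⟩)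
  · exact rightSplit_of_retract e.hom e.inv e.hom_inv_id sN
  · exact rightSplit_of_retract e.hom e.inv e.hom_inv_id sM
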